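/- Let $H$ be a separable infinite-dimensional complex Hilbert space. **Fréchet operator ideals.** A Fréchet operator ideal $\mathcal K_\tau$ is a two-sided ideal of $\mathcal L(H)$ that consists of compact operators and contains the finite rank operators, with a Fréchet topology $\tau$ for which the inclusion $\mathcal K_\tau\to\mathcal L(H)$ and the multiplications $\mathcal L(H)\times\mathcal K_\tau\to\mathcal K_\tau$, $\mathcal K_\tau\times\mathcal L(H)\to\mathcal K_\tau$ are continuous. We say that $\tau$ is finer than $\tau'$ if $\mathcal K_\tau\subset\mathcal K_{\tau'}$ with continuous inclusion. **Smooth algebras.** A (separable) smooth algebra is a separable Fréchet $*$-algebra $A^\infty$ (not necessarily unital) with a C*-norm $p$, i.e. a submultiplicative norm with $p(a^*a)=p(a)^2$; $A$ denotes its C*-completion. Morphisms of the smooth category are the continuous $*$-homomorphisms that are contractive for the C*-norms; they extend to the completions. **The monoid $\mathrm{Ext}_\tau(A^\infty)$.** A $\tau$-smooth extension of $(A^\infty,A)$ is a pair $(\pi,P)$ of a (possibly degenerate) representation $\pi$ of $A$ on $H$ and a projection $P$ in $H$ with $[\pi(a),P]\in\mathcal K_\tau$ for $a\in A^\infty$ and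 $P\pi(A)P\cap\mathcal K(H)=\{0\}$. Put $\phi(a)=P\pi(a)P$. Two extensions are unitarily equivalent if there is a unitary $u\in\mathcal L(H)$ with $u\phi_1(a)u^*-\phi_2(a)\in\mathcal K_\tau$ for all $a\in A^\infty$. An extension is degenerate if it is unitarily equivalent to one of the form $(\rho,1)$. Direct sum along a unitary $H\oplus H\cong H$ makes the unitary equivalence classes an abelian semigroup, and $\mathrm{Ext}_\tau(A^\infty)$ is its quotient by the degenerate classes: $x\sim y$ iff $x+d=y+e$ for some degenerate classes $d,e$. **The Brown–Douglas–Fillmore functor.** For a C*-algebra $A$, $\mathrm{Ext}(A)$ is the abelian monoid of unitary equivalence classes (by unitaries of $\mathcal L(H)$) of $*$-homomorphisms $\sigma:A\to\mathcal L(H)/\mathcal K(H)$, with direct sum as addition, modulo those that lift to a $*$-homomorphism $A\to\mathcal L(H)$. It is a contravariant functor of $A$ by composition; $(A^\infty,A)\mapsto\mathrm{Ext}(A)$ is the Brown–Douglas–Fillmore functor on the smooth category. **Claim.** 1. For every Fréchet operator ideal $\mathcal K_\tau$ and every separable smooth algebra $A^\infty$ the abelian monoid $\mathrm{Ext}_\tau(A^\infty)$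 is a group, and $\mathrm{Ext}_\tau$ is a contravariant functor from the smooth category to abelian groups, where a morphism $f:A^\infty\to B^\infty$ with extension $\bar f:A\to B$ induces $f^*[(\pi,P)]=[(\pi\circ\bar f,P)]$. 2. If $\tau$ is finer than $\tau'$, then $[(\pi,P)]\mapsto[(\pi,P)]$ is a well-defined natural transformation $\alpha_{\tau,\tau'}:\mathrm{Ext}_\tau\to\mathrm{Ext}_{\tau'}$. 3. For every $\tau$, sending $[(\pi,P)]$ to the class of $a\mapsto P\pi(a)P+\mathcal K(H)$ is a well-defined natural transformation $\alpha_\tau$ of functors to abelian monoids from $\mathrm{Ext}_\tau$ to the Brown–Douglas–Fillmore functor $\mathrm{Ext}$. -/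

import Mathlib

open CategoryTheory TopologicalSpace Opposite

universe u v

noncomputable section

/-! ### Fréchet spaces and C*-completions -/

/-- A complex Fréchet space: a complete metrizable locally convex topological vector space. -/
class IsFrechetSpace (E : Type*) [AddCommGroup E] [Module ℂ E] [TopologicalSpace E] : Prop
    extends IsTopologicalAddGroup E, ContinuousSMul ℂ E, LocallyConvexSpace ℝ E,
      MetrizableSpace E where
  complete : @CompleteSpace E (IsTopologicalAddGroup.rightUniformSpace E)

section Completion

set_option linter.unusedSectionVars false

open UniformSpace

namespace UniformSpace.Completion

section Ring

variable {α : Type u} [NonUnitalNormedRing α]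

/-- The product of the completion: the continuous extension of the product of `α`. -/
instance nonUnitalMul : Mul (Completion α) :=
  ⟨fun x y => (isDenseInducing_coe.prodMap isDenseInducing_coe).extend
    (fun p : α × α => ((p.1 * p.2 : α) : Completion α)) (x, y)⟩

theorem coe_mul_nonUnital (a b : α) : ((a * b : α) : Completion α) = a * b :=
  ((isDenseInducing_coe.prodMap isDenseInducing_coe).extend_eq
    ((continuous_coe α).comp (@continuous_mul α _ _ _)) (a, b)).symm

instance nonUnitalContinuousMul : ContinuousMul (Completion α) where
  continuous_mul := by
    let m := (AddMonoidHom.mul : α →+ α →+ α).compr₂ toCompl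
    have : Continuous fun p : α × α => m p.1 p.2 := (continuous_coe α).comp continuous_mul
    have di : IsDenseInducing (toCompl : α → Completion α) := isDenseInducing_coe
    exact (di.extend_Z_bilin di this :)

instance nonUnitalNormedRing : NonUnitalNormedRing (Completion α) :=
  { (inferInstance : NormedAddCommGroup (Completion α)),
    (inferInstance : Mul (Completion α)) with
    zero_mul := fun a => Completion.induction_on a (isClosed_eq (by fun_prop) continuous_const)
      fun a => by rw [← coe_zero, ← coe_mul_nonUnital, zero_mul]
    mul_zero := fun a => Completion.induction_on a (isClosed_eq (by fun_prop) continuous_const)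
      fun a => by rw [← coe_zero, ← coe_mul_nonUnital, mul_zero]
    mul_assoc := fun a b c =>
      Completion.induction_on₃ a b c (isClosed_eq (by fun_prop) (by fun_prop))
        fun a b c => by simp only [← coe_mul_nonUnital, mul_assoc]
    left_distrib := fun a b c =>
      Completion.induction_on₃ a b c (isClosed_eq (by fun_prop) (by fun_prop))
        fun a b c => by simp only [← coe_mul_nonUnital, ← coe_add, mul_add]
    right_distrib := fun a b c =>
      Completion.induction_on₃ a b c (isClosed_eq (by fun_prop) (by fun_prop))
        fun a b c => by simp only [← coe_mul_nonUnital, ← coe_add, add_mul]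
    norm_mul_le := fun a b =>
      Completion.induction_on₂ a b (isClosed_le (by fun_prop) (by fun_prop))
        fun a b => by
          rw [← coe_mul_nonUnital, norm_coe, norm_coe, norm_coe]
          exact norm_mul_le a b }

end Ring

section Star

variable {α : Type u} [NonUnitalNormedRing α] [StarRing α] [CStarRing α]

instance nonUnitalStar : Star (Completion α) := ⟨Completion.map star⟩

theorem coe_star_nonUnital (a : α) : ((star a : α) : Completion α) = star (a : Completion α) :=
  (map_coe (star_isometry (E := α)).uniformContinuous a).symm

theorem continuous_star_nonUnital : Continuous (star : Completion α → Completion α) :=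
  continuous_map

instance nonUnitalContinuousStar : ContinuousStar (Completion α) := ⟨continuous_star_nonUnital⟩

instance nonUnitalStarRing : StarRing (Completion α) where
  star_involutive a := Completion.induction_on a (isClosed_eq (by fun_prop) (by fun_prop))
    fun a => by simp only [← coe_star_nonUnital, star_star]
  star_mul a b := Completion.induction_on₂ a b (isClosed_eq (by fun_prop) (by fun_prop))
    fun a b => by simp only [← coe_mul_nonUnital, ← coe_star_nonUnital, star_mul]
  star_add a b := Completion.induction_on₂ a b (isClosed_eq (by fun_prop) (by fun_prop))
    fun a b => by simp only [← coe_add, ← coe_star_nonUnital, star_add]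

instance nonUnitalCStarRing : CStarRing (Completion α) where
  norm_mul_self_le a := Completion.induction_on a (isClosed_le (by fun_prop) (by fun_prop))
    fun a => by
      rw [← coe_star_nonUnital, ← coe_mul_nonUnital, norm_coe, norm_coe]
      exact CStarRing.norm_mul_self_le a

variable [NormedSpace ℂ α] [IsScalarTower ℂ α α] [SMulCommClass ℂ α α] [StarModule ℂ α]

theorem smul_mul_nonUnital (c : ℂ) (x y : Completion α) : (c • x) * y = c • (x * y) :=
  Completion.induction_on₂ x y
    (isClosed_eq ((continuous_fst.const_smul c).mul continuous_snd)
      ((continuous_fst.mul continuous_snd).const_smul c))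
    fun a b => by
      rw [← coe_smul, ← coe_mul_nonUnital, ← coe_mul_nonUnital, ← coe_smul, smul_mul_assoc]

theorem mul_smul_nonUnital (c : ℂ) (x y : Completion α) : x * (c • y) = c • (x * y) :=
  Completion.induction_on₂ x y
    (isClosed_eq (continuous_fst.mul (continuous_snd.const_smul c))
      ((continuous_fst.mul continuous_snd).const_smul c))
    fun a b => by
      rw [← coe_smul, ← coe_mul_nonUnital, ← coe_mul_nonUnital, ← coe_smul, mul_smul_comm]

theorem star_smul_nonUnital (c : ℂ) (x : Completion α) : star (c • x) = star c • star x :=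
  Completion.induction_on x
    (isClosed_eq (continuous_star.comp (continuous_const_smul c))
      (continuous_star.const_smul (star c)))
    fun a => by
      rw [← coe_smul, ← coe_star_nonUnital, ← coe_star_nonUnital, ← coe_smul, star_smul]

/-- The completion of a `*`-algebra with a C*-norm is a C*-algebra. -/
instance nonUnitalCStarAlgebra : NonUnitalCStarAlgebra (Completion α) where
  smul_assoc c x y := smul_mul_nonUnital c x y
  smul_comm c x y := (mul_smul_nonUnital c x y).symm
  star_smul c x := star_smul_nonUnital c x

variable {β : Type u} [NonUnitalNormedRing β] [StarRing β] [CStarRing β] [NormedSpace ℂ β]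
  [IsScalarTower ℂ β β] [SMulCommClass ℂ β β] [StarModule ℂ β]

/-- The extension of a contractive `*`-homomorphism to the completions. -/
def mapStarHom (f : α →⋆ₙₐ[ℂ] β) (hf : ∀ a, ‖f a‖ ≤ ‖a‖) : Completion α →⋆ₙₐ[ℂ] Completion β :=
  have hu : UniformContinuous f :=
    (AddMonoidHomClass.lipschitz_of_bound f 1 (by simpa using hf)).uniformContinuous
  have hc : Continuous (Completion.map f) := continuous_map
  { toFun := Completion.map f
    map_smul' := fun c x => Completion.induction_on x
      (isClosed_eq (hc.comp (continuous_const_smul c)) (hc.const_smul c))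
      fun a => by
        rw [← coe_smul, map_coe hu, map_coe hu, map_smul, coe_smul]
        rfl
    map_zero' := by rw [← coe_zero, map_coe hu, map_zero, coe_zero]
    map_add' := fun x y => Completion.induction_on₂ x y (isClosed_eq (by fun_prop) (by fun_prop))
      fun a b => by simp only [← coe_add, map_coe hu, map_add]
    map_mul' := fun x y => Completion.induction_on₂ x y (isClosed_eq (by fun_prop) (by fun_prop))
      fun a b => by simp only [← coe_mul_nonUnital, map_coe hu, map_mul]
    map_star' := fun x => Completion.induction_on x (isClosed_eq (by fun_prop) (by fun_prop))
      fun a => by simp only [← coe_star_nonUnital, map_coe hu, map_star] }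

theorem mapStarHom_coe (f : α →⋆ₙₐ[ℂ] β) (hf : ∀ a, ‖f a‖ ≤ ‖a‖) (a : α) :
    mapStarHom f hf a = f a :=
  map_coe (AddMonoidHomClass.lipschitz_of_bound f 1 (by simpa using hf)).uniformContinuous a

theorem continuous_mapStarHom (f : α →⋆ₙₐ[ℂ] β) (hf : ∀ a, ‖f a‖ ≤ ‖a‖) :
    Continuous (mapStarHom f hf) :=
  continuous_map

end Star

end UniformSpace.Completion

end Completion

/-! ### Smooth algebras -/

/-- A separable smooth algebra: a separable Fréchet `*`-algebra together with a C*-norm `p`. -/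
structure SmoothAlgebra : Type (u + 1) where
  carrier : Type u
  [ring : NonUnitalRing carrier]
  [module : Module ℂ carrier]
  [scalarTower : IsScalarTower ℂ carrier carrier]
  [smulComm : SMulCommClass ℂ carrier carrier]
  [starRing : StarRing carrier]
  [starModule : StarModule ℂ carrier]
  [topology : TopologicalSpace carrier]
  [frechet : IsFrechetSpace carrier]
  [continuousMul : ContinuousMul carrier]
  [continuousStar : ContinuousStar carrier]
  [separable : SeparableSpace carrier]
  p : Seminorm ℂ carrier
  eq_zero_of_p : ∀ a, p a = 0 → a = 0
  p_mul_le : ∀ a b, p (a * b) ≤ p a * p b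
  p_star_mul_self : ∀ a, p (star a * a) = p a ^ 2

namespace SmoothAlgebra

instance : CoeSort SmoothAlgebra.{u} (Type u) := ⟨carrier⟩

attribute [instance] ring module scalarTower smulComm starRing starModule topology frechet
  continuousMul continuousStar separable

/-- The algebra of `A`, regarded as a normed algebra with norm `p`. -/
def Normed (A : SmoothAlgebra.{u}) : Type u := A.carrier

section

variable (A : SmoothAlgebra.{u})

instance : NonUnitalRing A.Normed := A.ring
instance : Module ℂ A.Normed := A.module
instance : IsScalarTower ℂ A.Normed A.Normed := A.scalarTower
instance : SMulCommClass ℂ A.Normed A.Normed := A.smulComm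
instance : StarRing A.Normed := A.starRing
instance : StarModule ℂ A.Normed := A.starModule

instance : NormedAddCommGroup A.Normed :=
  AddGroupNorm.toNormedAddCommGroup (E := A.Normed)
    { toFun := A.p
      map_zero' := map_zero A.p
      add_le' := map_add_le_add A.p
      neg' := map_neg_eq_map A.p
      eq_zero_of_map_eq_zero' := A.eq_zero_of_p }

instance : NonUnitalNormedRing A.Normed :=
  { (inferInstance : NormedAddCommGroup A.Normed), (inferInstance : NonUnitalRing A.Normed) with
    norm_mul_le := A.p_mul_le }

instance : CStarRing A.Normed where
  norm_mul_self_le a := by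
    have := A.p_star_mul_self a
    rw [sq] at this
    exact this.ge

instance : NormedSpace ℂ A.Normed where
  norm_smul_le c a := (map_smul_eq_mul A.p c a).le

end

/-- The C*-algebra `A` of the pair `(A^∞, A)`: the completion with respect to `p`. -/
abbrev CStar (A : SmoothAlgebra.{u}) : Type u := UniformSpace.Completion A.Normed

/-- The inclusion of a smooth algebra in its C*-completion. -/
def ι (A : SmoothAlgebra.{u}) : A →⋆ₙₐ[ℂ] A.CStar where
  toFun a := ((show A.Normed from a : A.Normed) : UniformSpace.Completion A.Normed)
  map_smul' c a := UniformSpace.Completion.coe_smul (X := A.Normed) c a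
  map_zero' := UniformSpace.Completion.coe_zero (α := A.Normed)
  map_add' a b := UniformSpace.Completion.coe_add (α := A.Normed) a b
  map_mul' a b := UniformSpace.Completion.coe_mul_nonUnital (α := A.Normed) a b
  map_star' a := UniformSpace.Completion.coe_star_nonUnital (α := A.Normed) a

theorem norm_ι (A : SmoothAlgebra.{u}) (a : A) : ‖A.ι a‖ = A.p a :=
  UniformSpace.Completion.norm_coe (E := A.Normed) a

theorem denseRange_ι (A : SmoothAlgebra.{u}) : DenseRange A.ι :=
  UniformSpace.Completion.denseRange_coe (α := A.Normed)

/-- Morphisms of smooth algebras: continuous `*`-homomorphisms, contractive for the C*-norms. -/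
@[ext]
structure Hom (A B : SmoothAlgebra.{u}) where
  toHom : A →⋆ₙₐ[ℂ] B
  continuous_toHom : Continuous toHom
  contractive : ∀ a, B.p (toHom a) ≤ A.p a

/-- The smooth category. -/
instance : Category SmoothAlgebra.{u} where
  Hom := Hom
  id A := ⟨NonUnitalStarAlgHom.id ℂ A, continuous_id, fun _ => le_rfl⟩
  comp f g := ⟨g.toHom.comp f.toHom, g.continuous_toHom.comp f.continuous_toHom,
    fun a => (g.contractive _).trans (f.contractive a)⟩

variable {A B C : SmoothAlgebra.{u}}

/-- The extension of a morphism to the C*-completions. -/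
def Hom.extend (f : A ⟶ B) : A.CStar →⋆ₙₐ[ℂ] B.CStar :=
  UniformSpace.Completion.mapStarHom (α := A.Normed) (β := B.Normed) f.toHom f.contractive

theorem Hom.extend_ι (f : A ⟶ B) (a : A) : Hom.extend f (A.ι a) = B.ι (f.toHom a) :=
  UniformSpace.Completion.mapStarHom_coe (α := A.Normed) (β := B.Normed) f.toHom f.contractive a

theorem Hom.continuous_extend (f : A ⟶ B) : Continuous (Hom.extend f) :=
  UniformSpace.Completion.continuous_mapStarHom (α := A.Normed) (β := B.Normed) f.toHom f.contractive

theorem Hom.extend_id (A : SmoothAlgebra.{u}) :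
    Hom.extend (𝟙 A) = NonUnitalStarAlgHom.id ℂ A.CStar :=
  DFunLike.coe_injective <| A.denseRange_ι.equalizer (Hom.continuous_extend _) continuous_id <|
    funext fun a => Hom.extend_ι (𝟙 A) a

theorem Hom.extend_comp (f : A ⟶ B) (g : B ⟶ C) :
    Hom.extend (f ≫ g) = (Hom.extend g).comp (Hom.extend f) :=
  DFunLike.coe_injective <| A.denseRange_ι.equalizer (Hom.continuous_extend _)
    ((Hom.continuous_extend g).comp (Hom.continuous_extend f)) <| funext fun a => by
      change Hom.extend (f ≫ g) (A.ι a) = Hom.extend g (Hom.extend f (A.ι a))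
      rw [Hom.extend_ι, Hom.extend_ι, Hom.extend_ι]
      rfl

end SmoothAlgebra

/-! ### Operator ideals -/

section Operators

set_option linter.unusedSectionVars false
set_option linter.unusedSimpArgs false
set_option linter.unusedTactic false

variable {H : Type v} [NormedAddCommGroup H] [InnerProductSpace ℂ H] [CompleteSpace H]

/-- A Fréchet operator ideal `K_τ` of `L(H)`: a two-sided ideal of compact operators containing
the finite rank operators, with a Fréchet topology `τ` for which the inclusion in `L(H)` and the
multiplications by bounded operators are continuous. -/
structure FrechetOperatorIdeal (H : Type v) [NormedAddCommGroup H] [InnerProductSpace ℂ H]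
    [CompleteSpace H] where
  ideal : Submodule ℂ (H →L[ℂ] H)
  mul_mem_left : ∀ (S : H →L[ℂ] H) {T : H →L[ℂ] H}, T ∈ ideal → S * T ∈ ideal
  mul_mem_right : ∀ {T : H →L[ℂ] H} (S : H →L[ℂ] H), T ∈ ideal → T * S ∈ ideal
  finiteRank_mem : ∀ T : H →L[ℂ] H, FiniteDimensional ℂ T.range → T ∈ ideal
  isCompactOperator : ∀ T ∈ ideal, IsCompactOperator T
  τ : TopologicalSpace ideal
  frechet : @IsFrechetSpace ideal _ _ τ
  continuous_incl : @Continuous ideal (H →L[ℂ] H) τ _ Subtype.val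
  continuous_mul_left : @Continuous ((H →L[ℂ] H) × ideal) ideal
    (@instTopologicalSpaceProd _ _ _ τ) τ fun x => ⟨x.1 * x.2, mul_mem_left x.1 x.2.2⟩
  continuous_mul_right : @Continuous (ideal × (H →L[ℂ] H)) ideal
    (@instTopologicalSpaceProd _ _ τ _) τ fun x => ⟨x.1 * x.2, mul_mem_right x.2 x.1.2⟩

/-- `τ` is finer than `τ'`: `K_τ` is contained in `K_τ'`, and the inclusion is continuous. -/
structure FrechetOperatorIdeal.Finer (τ τ' : FrechetOperatorIdeal H) : Prop where
  le : τ.ideal ≤ τ'.ideal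
  continuous_inclusion : @Continuous τ.ideal τ'.ideal τ.τ τ'.τ (Submodule.inclusion le)

theorem isCompactOperator_mul_left (S : H →L[ℂ] H) {T : H →L[ℂ] H} (hT : IsCompactOperator T) :
    IsCompactOperator (S * T : H →L[ℂ] H) :=
  hT.clm_comp S

theorem isCompactOperator_mul_right {T : H →L[ℂ] H} (hT : IsCompactOperator T) (S : H →L[ℂ] H) :
    IsCompactOperator (T * S : H →L[ℂ] H) :=
  hT.comp_clm S

/-- The adjoint of a compact operator is compact. -/
theorem isCompactOperator_star {T : H →L[ℂ] H} (hT : IsCompactOperator T) :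
    IsCompactOperator (star T : H →L[ℂ] H) := by
  have hc : IsCompactOperator (T * star T : H →L[ℂ] H) := isCompactOperator_mul_right hT _
  suffices TotallyBounded ((star T : H →L[ℂ] H) '' Metric.closedBall 0 1) by
    change IsCompactOperator ((star T : H →L[ℂ] H) : H →ₗ[ℂ] H)
    rw [isCompactOperator_iff_isCompact_closure_image_closedBall _ zero_lt_one]
    exact this.closure.isCompact_of_isClosed isClosed_closure
  have htb : TotallyBounded ((T * star T : H →L[ℂ] H) '' Metric.closedBall 0 1) :=
    (IsCompactOperator.isCompact_closure_image_closedBall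
      (f := ((T * star T : H →L[ℂ] H) : H →ₗ[ℂ] H)) hc 1).totallyBounded.subset subset_closure
  rw [Metric.totallyBounded_iff]
  intro ε hε
  obtain ⟨t, hts, htf, ht⟩ := Metric.finite_approx_of_totallyBounded htb (ε ^ 2 / 2) (by positivity)
  choose! g hg using fun y (hy : y ∈ t) => hts hy
  refine ⟨(fun y => (star T : H →L[ℂ] H) (g y)) '' t, htf.image _, ?_⟩
  rintro _ ⟨x, hx, rfl⟩
  have := ht ⟨x, hx, rfl⟩
  simp only [Set.mem_iUnion, exists_prop] at this
  obtain ⟨y, hy, hxy⟩ := this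
  simp only [Set.mem_iUnion, exists_prop]
  refine ⟨_, ⟨y, hy, rfl⟩, ?_⟩
  obtain ⟨hgy, hgy'⟩ := hg y hy
  rw [Metric.mem_ball, dist_eq_norm] at hxy ⊢
  rw [← hgy', ← map_sub] at hxy
  rw [← map_sub]
  have hz : ‖x - g y‖ ≤ 2 := by
    have h1 : ‖x‖ ≤ 1 := by simpa using hx
    have h2 : ‖g y‖ ≤ 1 := by simpa using hgy
    linarith [norm_sub_le x (g y)]
  set z := x - g y
  have key : ‖(star T : H →L[ℂ] H) z‖ ^ 2 ≤ ‖z‖ * ‖(T * star T : H →L[ℂ] H) z‖ := by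
    have h := norm_inner_le_norm (𝕜 := ℂ) z ((T * star T : H →L[ℂ] H) z)
    rw [mul_apply_eq_comp, ← ContinuousLinearMap.adjoint_inner_left,
      ← ContinuousLinearMap.star_eq_adjoint, inner_self_eq_norm_sq_to_K] at h
    simpa using h
  have hn := norm_nonneg ((T * star T : H →L[ℂ] H) z)
  have : ‖(star T : H →L[ℂ] H) z‖ ^ 2 < ε ^ 2 := by nlinarith
  exact lt_of_pow_lt_pow_left₀ 2 hε.le this

theorem isClosed_compact : IsClosed {T : H →L[ℂ] H | IsCompactOperator T} :=
  isClosed_setOfPred_isCompactOperator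

/-- Congruence of bounded operators modulo the compact operators. -/
def calkinCon (H : Type v) [NormedAddCommGroup H] [InnerProductSpace ℂ H] [CompleteSpace H] :
    RingCon (H →L[ℂ] H) where
  r S T := IsCompactOperator (S - T : H →L[ℂ] H)
  iseqv :=
    { refl := fun S => by rw [sub_self]; exact isCompactOperator_zero
      symm := fun {S T} h => by
        rw [← neg_sub]
        exact h.neg
      trans := fun {R S T} h k => by
        rw [← sub_add_sub_cancel R S T]
        exact h.add k }
  add' {S T R Q} h k := by
    change IsCompactOperator ((S + R) - (T + Q) : H →L[ℂ] H)
    rw [add_sub_add_comm]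
    exact h.add k
  mul' {S T R Q} h k := by
    change IsCompactOperator (S * R - T * Q : H →L[ℂ] H)
    have : S * R - T * Q = S * (R - Q) + (S - T) * Q := by noncomm_ring
    rw [this]
    exact (isCompactOperator_mul_left S k).add (isCompactOperator_mul_right h Q)

/-- The Calkin algebra `L(H)/K(H)`. -/
def Calkin (H : Type v) [NormedAddCommGroup H] [InnerProductSpace ℂ H] [CompleteSpace H] :
    Type v :=
  (calkinCon H).Quotient

namespace Calkin

instance : Ring (Calkin H) := inferInstanceAs (Ring (calkinCon H).Quotient)

instance : Algebra ℂ (Calkin H) := inferInstanceAs (Algebra ℂ (calkinCon H).Quotient)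

/-- The class of a bounded operator modulo the compact operators. -/
def mk (T : H →L[ℂ] H) : Calkin H := (T : (calkinCon H).Quotient)

theorem mk_eq {S T : H →L[ℂ] H} : mk S = mk T ↔ IsCompactOperator (S - T : H →L[ℂ] H) :=
  RingCon.eq (calkinCon H)

theorem mk_surjective (x : Calkin H) : ∃ T : H →L[ℂ] H, mk T = x :=
  Quotient.exists_rep x

theorem mk_mul (S T : H →L[ℂ] H) : mk (S * T) = mk S * mk T := rfl

theorem mk_add (S T : H →L[ℂ] H) : mk (S + T) = mk S + mk T := rfl

theorem mk_smul (c : ℂ) (T : H →L[ℂ] H) : mk (c • T) = c • mk T := rfl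

instance : Star (Calkin H) :=
  ⟨Quotient.map' star fun S T h => by
    have := isCompactOperator_star h
    rw [star_sub] at this
    exact this⟩

theorem mk_star (T : H →L[ℂ] H) : mk (star T) = star (mk T) := rfl

instance : StarRing (Calkin H) where
  star_involutive x := by
    obtain ⟨T, rfl⟩ := mk_surjective x
    rw [← mk_star, ← mk_star, star_star]
  star_mul x y := by
    obtain ⟨S, rfl⟩ := mk_surjective x
    obtain ⟨T, rfl⟩ := mk_surjective y
    rw [← mk_star, ← mk_star, ← mk_mul, ← mk_mul, ← mk_star, star_mul]
  star_add x y := by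
    obtain ⟨S, rfl⟩ := mk_surjective x
    obtain ⟨T, rfl⟩ := mk_surjective y
    rw [← mk_star, ← mk_star, ← mk_add, ← mk_add, ← mk_star, star_add]

instance : StarModule ℂ (Calkin H) where
  star_smul c x := by
    obtain ⟨T, rfl⟩ := mk_surjective x
    rw [← mk_star, ← mk_smul, ← mk_smul, ← mk_star, star_smul]

/-- The quotient map `L(H) → L(H)/K(H)`. -/
def q : (H →L[ℂ] H) →⋆ₐ[ℂ] Calkin H where
  toFun := mk
  map_one' := rfl
  map_mul' _ _ := rfl
  map_zero' := rfl
  map_add' _ _ := rfl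
  commutes' _ := rfl
  map_star' _ := rfl

theorem q_eq {S T : H →L[ℂ] H} : q S = q T ↔ IsCompactOperator (S - T : H →L[ℂ] H) := mk_eq

end Calkin

/-! ### Spatial isomorphisms -/

/-- A pair of elements `s`, `t` such that the row `(s, t)` is unitary. For `L(H)` this is a
unitary from `H ⊕ H` to `H`, and the corresponding spatial isomorphism from `M₂(L(H))` to `L(H)`
sends `diag(a, b)` to `s a s* + t b t*`. -/
structure IsometryPair (R : Type*) [Ring R] [StarRing R] where
  s : R
  t : R
  star_s_mul_s : star s * s = 1
  star_t_mul_t : star t * t = 1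
  add_eq_one : s * star s + t * star t = 1

namespace IsometryPair

variable {R : Type*} [Ring R] [StarRing R] (V V' : IsometryPair R)

theorem star_s_mul_t : star V.s * V.t = 0 := by
  have h : star V.s * (V.s * star V.s + V.t * star V.t) * V.t = star V.s * V.t := by
    rw [V.add_eq_one, mul_one]
  have h' : star V.s * (V.s * star V.s + V.t * star V.t) * V.t =
      (star V.s * V.s) * (star V.s * V.t) + (star V.s * V.t) * (star V.t * V.t) := by noncomm_ring
  rw [V.star_s_mul_s, V.star_t_mul_t, one_mul, mul_one, h] at h'
  simpa using h'

theorem star_t_mul_s : star V.t * V.s = 0 := by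
  simpa using congrArg star V.star_s_mul_t

theorem star_s_mul_s' (x : R) : star V.s * (V.s * x) = x := by
  rw [← mul_assoc, V.star_s_mul_s, one_mul]

theorem star_t_mul_t' (x : R) : star V.t * (V.t * x) = x := by
  rw [← mul_assoc, V.star_t_mul_t, one_mul]

theorem star_s_mul_t' (x : R) : star V.s * (V.t * x) = 0 := by
  rw [← mul_assoc, V.star_s_mul_t, zero_mul]

theorem star_t_mul_s' (x : R) : star V.t * (V.s * x) = 0 := by
  rw [← mul_assoc, V.star_t_mul_s, zero_mul]

/-- The diagonal sum `s a s* + t b t*`. -/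
def diag (a b : R) : R := V.s * a * star V.s + V.t * b * star V.t

theorem diag_mul (a b c d : R) : V.diag a b * V.diag c d = V.diag (a * c) (b * d) := by
  simp only [diag, mul_add, add_mul, mul_assoc, star_s_mul_s', star_t_mul_t', star_s_mul_t',
    star_t_mul_s', mul_zero, add_zero, zero_add]

theorem diag_add (a b c d : R) : V.diag a b + V.diag c d = V.diag (a + c) (b + d) := by
  simp only [diag]; noncomm_ring

theorem diag_sub (a b c d : R) : V.diag a b - V.diag c d = V.diag (a - c) (b - d) := by
  simp only [diag]; noncomm_ring

theorem star_diag (a b : R) : star (V.diag a b) = V.diag (star a) (star b) := by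
  simp only [diag, star_add, star_mul, star_star, mul_assoc]

theorem diag_zero : V.diag 0 0 = 0 := by simp [diag]

theorem diag_one : V.diag 1 1 = 1 := by simp [diag, V.add_eq_one]

theorem star_s_diag_s (a b : R) : star V.s * V.diag a b * V.s = a := by
  simp only [diag, mul_add, add_mul, mul_assoc, star_s_mul_s', star_s_mul_s, star_s_mul_t',
    star_t_mul_s, mul_zero, add_zero, mul_one]

theorem star_t_diag_t (a b : R) : star V.t * V.diag a b * V.t = b := by
  simp only [diag, mul_add, add_mul, mul_assoc, star_t_mul_t', star_t_mul_t, star_s_mul_t,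
    star_t_mul_s', mul_zero, zero_add, mul_one]

/-- The diagonal sum of two unitaries. -/
def diagUnitary (u v : unitary R) : unitary R :=
  ⟨V.diag u v, by
    rw [Unitary.mem_iff, star_diag, diag_mul, diag_mul]
    simp [diag_one]⟩

/-- The unitary comparing two isometry pairs. -/
def changeUnitary : unitary R :=
  ⟨V'.s * star V.s + V'.t * star V.t, by
    rw [Unitary.mem_iff]
    constructor <;>
    simp only [star_add, star_mul, star_star, mul_add, add_mul, mul_assoc, star_s_mul_s',
      star_s_mul_t', star_t_mul_s', star_t_mul_t', mul_zero, add_zero, zero_add, add_eq_one]⟩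

theorem changeUnitary_conj (a b : R) :
    (V.changeUnitary V' : R) * V.diag a b * star (V.changeUnitary V' : R) = V'.diag a b := by
  simp only [changeUnitary, diag, star_add, star_mul, star_star, mul_add, add_mul, mul_assoc,
    star_s_mul_s', star_s_mul_t', star_t_mul_s', star_t_mul_t', star_s_mul_s, star_s_mul_t,
    star_t_mul_s, star_t_mul_t, mul_zero, add_zero, zero_add]

/-- The unitary interchanging two summands. -/
def swapUnitary : unitary R :=
  ⟨V.s * star V.t + V.t * star V.s, by
    rw [Unitary.mem_iff]
    constructor <;>
    simp only [star_add, star_mul, star_star, mul_add, add_mul, mul_assoc, star_s_mul_s',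
      star_s_mul_t', star_t_mul_s', star_t_mul_t', mul_zero, add_zero, zero_add, add_eq_one]
    rw [add_comm, add_eq_one]⟩

theorem swapUnitary_conj (a b : R) :
    (V.swapUnitary : R) * V.diag a b * star (V.swapUnitary : R) = V.diag b a := by
  simp only [swapUnitary, diag, star_add, star_mul, star_star, mul_add, add_mul, mul_assoc,
    star_s_mul_s', star_s_mul_t', star_t_mul_s', star_t_mul_t', mul_zero, add_zero, zero_add]

/-- The unitary reassociating three summands. -/
def assocUnitary : unitary R :=
  ⟨V.s * star V.s * star V.s + V.t * V.s * star V.t * star V.s + V.t * V.t * star V.t, by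
    have h (x : R) : V.s * (star V.s * x) + V.t * (star V.t * x) = x := by
      rw [← mul_assoc, ← mul_assoc, ← add_mul, add_eq_one, one_mul]
    rw [Unitary.mem_iff]
    constructor
    · simp only [star_add, star_mul, star_star, mul_add, add_mul, mul_assoc, star_s_mul_s',
        star_s_mul_t', star_t_mul_s', star_t_mul_t', mul_zero, add_zero, zero_add]
      rw [← mul_add, h, add_eq_one]
    · simp only [star_add, star_mul, star_star, mul_add, add_mul, mul_assoc, star_s_mul_s',
        star_s_mul_t', star_t_mul_s', star_t_mul_t', mul_zero, add_zero, zero_add]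
      rw [add_assoc, ← mul_add, h, add_eq_one]⟩

theorem assocUnitary_conj (a b c : R) :
    (V.assocUnitary : R) * V.diag (V.diag a b) c * star (V.assocUnitary : R) =
      V.diag a (V.diag b c) := by
  simp only [assocUnitary, diag, star_add, star_mul, star_star, mul_add, add_mul, mul_assoc,
    star_s_mul_s', star_s_mul_t', star_t_mul_s', star_t_mul_t', mul_zero, add_zero, zero_add,
    add_assoc]

/-- The image of an isometry pair under a unital `*`-homomorphism. -/
def map {S : Type*} [Ring S] [StarRing S] [Algebra ℂ R] [Algebra ℂ S] (f : R →⋆ₐ[ℂ] S) :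
    IsometryPair S where
  s := f V.s
  t := f V.t
  star_s_mul_s := by rw [← map_star, ← map_mul, V.star_s_mul_s, map_one]
  star_t_mul_t := by rw [← map_star, ← map_mul, V.star_t_mul_t, map_one]
  add_eq_one := by
    rw [← map_star, ← map_mul, ← map_star, ← map_mul, ← map_add, V.add_eq_one, map_one]

theorem map_diag {S : Type*} [Ring S] [StarRing S] [Algebra ℂ R] [Algebra ℂ S] (f : R →⋆ₐ[ℂ] S)
    (a b : R) : (V.map f).diag (f a) (f b) = f (V.diag a b) := by
  simp only [diag, map, map_add, map_mul, map_star]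

/-- The direct sum of two `*`-homomorphisms. -/
def sumHom {B : Type*} [NonUnitalNonAssocSemiring B] [Module ℂ B] [Star B] [Algebra ℂ R]
    (f g : B →⋆ₙₐ[ℂ] R) : B →⋆ₙₐ[ℂ] R where
  toFun x := V.diag (f x) (g x)
  map_smul' c x := by simp [diag]
  map_zero' := by simp [diag]
  map_add' x y := by rw [map_add, map_add, diag_add]
  map_mul' x y := by rw [map_mul, map_mul, diag_mul]
  map_star' x := by rw [map_star, map_star, star_diag]

end IsometryPair

/-- An infinite-dimensional separable Hilbert space has a Hilbert basis indexed by `ℕ`. -/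
theorem exists_hilbertBasis_nat (E : Type*) [NormedAddCommGroup E] [InnerProductSpace ℂ E]
    [CompleteSpace E] [SeparableSpace E] (hE : ¬ FiniteDimensional ℂ E) :
    Nonempty (HilbertBasis ℕ ℂ E) := by
  obtain ⟨w, b, hb⟩ := exists_hilbertBasis ℂ E
  have hcount : Countable w := by
    have hpw : Pairwise (Function.onFun Disjoint fun i : w => Metric.ball (b i) (1 / 2)) := by
      intro i j hij
      apply Metric.ball_disjoint_ball
      have h1 : ‖b i - b j‖ ^ 2 = 2 := by
        rw [@norm_sub_sq ℂ, b.orthonormal.1 i, b.orthonormal.1 j, b.orthonormal.2 hij]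
        norm_num
      rw [dist_eq_norm]
      nlinarith [norm_nonneg (b i - b j)]
    exact hpw.countable_of_isOpen_disjoint (fun _ => Metric.isOpen_ball)
      fun i => ⟨b i, Metric.mem_ball_self (by norm_num)⟩
  have hinf : Infinite w := by
    by_contra hfin
    rw [not_infinite_iff_finite] at hfin
    have := Fintype.ofFinite w
    exact hE (b.toOrthonormalBasis.toBasis.finiteDimensional_of_finite)
  obtain ⟨e⟩ := nonempty_equiv_of_countable (α := ℕ) (β := w)
  refine ⟨HilbertBasis.mk (v := fun n => b (e n)) (b.orthonormal.comp e e.injective) ?_⟩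
  rw [show (fun n => b (e n)) = b ∘ e from rfl, e.surjective.range_comp]
  exact b.dense_span.ge

/-- For a separable infinite-dimensional `H` there is a unitary from `H ⊕ H` to `H`. -/
instance nonempty_isometryPair [SeparableSpace H] [hH : Fact (¬ FiniteDimensional ℂ H)] :
    Nonempty (IsometryPair (H →L[ℂ] H)) := by
  obtain ⟨b⟩ := exists_hilbertBasis_nat H hH.out
  have hHH : ¬ FiniteDimensional ℂ (WithLp 2 (H × H)) := fun _ =>
    hH.out (FiniteDimensional.of_surjective (WithLp.fstₗ 2 ℂ H H) fun x => ⟨WithLp.toLp 2 (x, 0), rfl⟩)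
  obtain ⟨c⟩ := exists_hilbertBasis_nat (WithLp 2 (H × H)) hHH
  let V : WithLp 2 (H × H) ≃ₗᵢ[ℂ] H := c.repr.trans b.repr.symm
  let j : (H × H) ≃L[ℂ] WithLp 2 (H × H) := (WithLp.prodContinuousLinearEquiv 2 ℂ H H).symm
  let V' : WithLp 2 (H × H) →L[ℂ] H := V.toContinuousLinearEquiv
  let W' : H →L[ℂ] WithLp 2 (H × H) := V.symm.toContinuousLinearEquiv
  let s : H →L[ℂ] H := V' ∘L (j : (H × H) →L[ℂ] WithLp 2 (H × H)) ∘L ContinuousLinearMap.inl ℂ H H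
  let t : H →L[ℂ] H := V' ∘L (j : (H × H) →L[ℂ] WithLp 2 (H × H)) ∘L ContinuousLinearMap.inr ℂ H H
  let s' : H →L[ℂ] H := WithLp.fstL 2 ℂ H H ∘L W'
  let t' : H →L[ℂ] H := WithLp.sndL 2 ℂ H H ∘L W'
  have hs : ∀ x, s x = V (WithLp.toLp 2 (x, 0)) := fun _ => rfl
  have ht : ∀ x, t x = V (WithLp.toLp 2 (0, x)) := fun _ => rfl
  have hs' : ∀ x, s' x = (V.symm x).fst := fun _ => rfl
  have ht' : ∀ x, t' x = (V.symm x).snd := fun _ => rfl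
  have hinner : ∀ x y, inner ℂ (V x) y = inner ℂ x (V.symm y) := fun x y => by
    rw [← V.symm.inner_map_map, V.symm_apply_apply]
  have es : star s = s' := by
    rw [ContinuousLinearMap.star_eq_adjoint, eq_comm, ← ContinuousLinearMap.adjoint_adjoint s']
    congr 1
    rw [eq_comm, ContinuousLinearMap.eq_adjoint_iff]
    intro x y
    rw [hs, hs', hinner, WithLp.prod_inner_apply]
    simp
  have et : star t = t' := by
    rw [ContinuousLinearMap.star_eq_adjoint, eq_comm, ← ContinuousLinearMap.adjoint_adjoint t']
    congr 1
    rw [eq_comm, ContinuousLinearMap.eq_adjoint_iff]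
    intro x y
    rw [ht, ht', hinner, WithLp.prod_inner_apply]
    simp
  refine ⟨⟨s, t, ?_, ?_, ?_⟩⟩
  · rw [es]
    ext x
    change s' (s x) = x
    rw [hs, hs', V.symm_apply_apply, WithLp.toLp_fst]
  · rw [et]
    ext x
    change t' (t x) = x
    rw [ht, ht', V.symm_apply_apply, WithLp.toLp_snd]
  · rw [es, et]
    ext x
    change s (s' x) + t (t' x) = x
    rw [hs, hs', ht, ht', ← map_add, ← WithLp.toLp_add]
    simp only [Prod.mk_add_mk, add_zero, zero_add]
    exact V.apply_symm_apply x

end Operators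

/-! ### Quotients of semigroups by degenerate elements -/

section Stable

variable {S : Type*} [AddCommSemigroup S]

/-- `x` and `y` are identified if `x + d = y + e` for some `d`, `e` in the subsemigroup `D`. -/
def stableCon (D : AddSubsemigroup S) (hD : (D : Set S).Nonempty) : AddCon S where
  r x y := ∃ d ∈ D, ∃ e ∈ D, x + d = y + e
  iseqv :=
    { refl := fun _ => ⟨_, hD.choose_spec, _, hD.choose_spec, rfl⟩
      symm := fun ⟨d, hd, e, he, h⟩ => ⟨e, he, d, hd, h.symm⟩
      trans := fun {x y z} ⟨d, hd, e, he, h⟩ ⟨d', hd', e', he', h'⟩ =>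
        ⟨d + d', D.add_mem hd hd', e' + e, D.add_mem he' he, by
          rw [← add_assoc, h, add_assoc, add_comm e d', ← add_assoc, h', add_assoc]⟩ }
  add' := fun {w x y z} ⟨d, hd, e, he, h⟩ ⟨d', hd', e', he', h'⟩ =>
    ⟨d + d', D.add_mem hd hd', e + e', D.add_mem he he', by
      rw [add_add_add_comm, h, h', add_add_add_comm]⟩

/-- The quotient of an abelian semigroup by a nonempty subsemigroup. -/
def StableQuotient (D : AddSubsemigroup S) (hD : (D : Set S).Nonempty) : Type _ :=
  (stableCon D hD).Quotient

namespace StableQuotient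

variable {D : AddSubsemigroup S} {hD : (D : Set S).Nonempty}

/-- The class of an element. -/
def mk (x : S) : StableQuotient D hD := ((x : (stableCon D hD).Quotient))

theorem mk_eq {x y : S} :
    (mk x : StableQuotient D hD) = mk y ↔ ∃ d ∈ D, ∃ e ∈ D, x + d = y + e :=
  (stableCon D hD).eq

theorem mk_surjective (x : StableQuotient D hD) : ∃ y, mk y = x := Quotient.exists_rep x

instance : AddCommSemigroup (StableQuotient D hD) :=
  inferInstanceAs (AddCommSemigroup (stableCon D hD).Quotient)

theorem mk_add (x y : S) : (mk (x + y) : StableQuotient D hD) = mk x + mk y := rfl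

theorem mk_add_of_mem (x : S) {d : S} (hd : d ∈ D) : (mk (x + d) : StableQuotient D hD) = mk x :=
  mk_eq.2 ⟨d, hd, d + d, D.add_mem hd hd, add_assoc x d d⟩

/-- The zero element of the quotient is the class of the elements of `D`. -/
instance : AddCommMonoid (StableQuotient D hD) :=
  letI : Zero (StableQuotient D hD) := ⟨mk hD.choose⟩
  { (inferInstance : AddCommSemigroup (StableQuotient D hD)) with
    zero_add := fun x => by
      obtain ⟨y, rfl⟩ := mk_surjective x
      change mk hD.choose + mk y = mk y
      rw [add_comm, ← mk_add, mk_add_of_mem y hD.choose_spec]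
    add_zero := fun x => by
      obtain ⟨y, rfl⟩ := mk_surjective x
      change mk y + mk hD.choose = mk y
      rw [← mk_add, mk_add_of_mem y hD.choose_spec]
    nsmul := nsmulRec }

theorem mk_of_mem {d : S} (hd : d ∈ D) : (mk d : StableQuotient D hD) = 0 :=
  mk_eq.2 ⟨hD.choose, hD.choose_spec, d, hd, add_comm _ _⟩

/-- The homomorphism induced by an additive map which preserves the subsemigroups. -/
def map {S' : Type*} [AddCommSemigroup S'] {D' : AddSubsemigroup S'}
    {hD' : (D' : Set S').Nonempty} (f : S →ₙ+ S') (hf : ∀ d ∈ D, f d ∈ D') :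
    StableQuotient D hD →+ StableQuotient D' hD' where
  toFun := Quotient.lift (fun x => mk (f x)) fun _ _ ⟨d, hd, e, he, h⟩ =>
    mk_eq.2 ⟨f d, hf d hd, f e, hf e he, by rw [← map_add, ← map_add, h]⟩
  map_zero' := mk_of_mem (hf _ hD.choose_spec)
  map_add' x y := by
    obtain ⟨x, rfl⟩ := mk_surjective x
    obtain ⟨y, rfl⟩ := mk_surjective y
    change mk (f (x + y)) = mk (f x) + mk (f y)
    rw [map_add, mk_add]

theorem map_mk {S' : Type*} [AddCommSemigroup S'] {D' : AddSubsemigroup S'}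
    {hD' : (D' : Set S').Nonempty} (f : S →ₙ+ S') (hf : ∀ d ∈ D, f d ∈ D') (x : S) :
    (map f hf : StableQuotient D hD →+ StableQuotient D' hD') (mk x) = mk (f x) := rfl

end StableQuotient

end Stable

/-! ### Smooth extensions -/

section Extensions

set_option linter.unusedSectionVars false

variable {H : Type v} [NormedAddCommGroup H] [InnerProductSpace ℂ H] [CompleteSpace H]

/-- A `τ`-smooth extension `(π, P)` of `(A^∞, A)`: a representation `π` of the C*-algebra `A` on
`H` and a projection `P` in `H` such that `[π(a), P] ∈ K_τ` for `a ∈ A^∞`, and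
`P π(A) P ∩ K(H) = {0}`. -/
structure SmoothExtension (τ : FrechetOperatorIdeal H) (A : SmoothAlgebra.{u}) where
  π : A.CStar →⋆ₙₐ[ℂ] (H →L[ℂ] H)
  P : H →L[ℂ] H
  isStarProjection : IsStarProjection P
  commutator_mem : ∀ a : A, π (A.ι a) * P - P * π (A.ι a) ∈ τ.ideal
  eq_zero_of_compact : ∀ a : A.CStar,
    IsCompactOperator (P * π a * P : H →L[ℂ] H) → P * π a * P = 0

namespace SmoothExtension

variable {τ τ' : FrechetOperatorIdeal H} {A B C : SmoothAlgebra.{u}}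

/-- The completely positive map `a ↦ P π(a) P` of a smooth extension. -/
def φ (x : SmoothExtension τ A) (a : A.CStar) : H →L[ℂ] H := x.P * x.π a * x.P

/-- Unitary equivalence of smooth extensions: the completely positive maps on `A^∞` are
unitarily conjugate up to perturbations in `K_τ`. -/
def UnitarilyEquivalent (x y : SmoothExtension τ A) : Prop :=
  ∃ u : unitary (H →L[ℂ] H), ∀ a : A,
    (u : H →L[ℂ] H) * x.φ (A.ι a) * star (u : H →L[ℂ] H) - y.φ (A.ι a) ∈ τ.ideal

theorem UnitarilyEquivalent.refl (x : SmoothExtension τ A) : UnitarilyEquivalent x x :=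
  ⟨1, fun a => by simp⟩

theorem UnitarilyEquivalent.symm {x y : SmoothExtension τ A} :
    UnitarilyEquivalent x y → UnitarilyEquivalent y x := fun ⟨u, hu⟩ =>
  ⟨star u, fun a => by
    have h := τ.mul_mem_right (u : H →L[ℂ] H)
      (τ.mul_mem_left (star (u : H →L[ℂ] H)) (τ.ideal.neg_mem (hu a)))
    have h1 : star (u : H →L[ℂ] H) * (u : H →L[ℂ] H) = 1 := Unitary.coe_star_mul_self u
    have h2 : star (u : H →L[ℂ] H) *
        (-((u : H →L[ℂ] H) * x.φ (A.ι a) * star (u : H →L[ℂ] H) - y.φ (A.ι a))) *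
        (u : H →L[ℂ] H) = star (u : H →L[ℂ] H) * y.φ (A.ι a) * (u : H →L[ℂ] H) -
        (star (u : H →L[ℂ] H) * (u : H →L[ℂ] H)) * x.φ (A.ι a) *
        (star (u : H →L[ℂ] H) * (u : H →L[ℂ] H)) := by noncomm_ring
    rw [h2, h1, one_mul, mul_one] at h
    simpa using h⟩

theorem UnitarilyEquivalent.trans {x y z : SmoothExtension τ A} :
    UnitarilyEquivalent x y → UnitarilyEquivalent y z → UnitarilyEquivalent x z :=
  fun ⟨u, hu⟩ ⟨w, hw⟩ => ⟨w * u, fun a => by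
    have h := τ.ideal.add_mem (τ.mul_mem_right (star (w : H →L[ℂ] H))
      (τ.mul_mem_left (w : H →L[ℂ] H) (hu a))) (hw a)
    convert h using 1
    rw [Submonoid.coe_mul, star_mul]
    noncomm_ring⟩

theorem UnitarilyEquivalent.of_eq {x y : SmoothExtension τ A} (u : unitary (H →L[ℂ] H))
    (h : ∀ a, (u : H →L[ℂ] H) * x.φ a * star (u : H →L[ℂ] H) = y.φ a) :
    UnitarilyEquivalent x y :=
  ⟨u, fun a => by rw [h, sub_self]; exact τ.ideal.zero_mem⟩

instance setoid (τ : FrechetOperatorIdeal H) (A : SmoothAlgebra.{u}) :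
    Setoid (SmoothExtension τ A) where
  r := UnitarilyEquivalent
  iseqv := ⟨.refl, .symm, .trans⟩

/-- A smooth extension is degenerate if it is unitarily equivalent to a representation, that is,
to an extension `(ρ, 1)`. -/
def IsDegenerate (x : SmoothExtension τ A) : Prop :=
  ∃ y : SmoothExtension τ A, y.P = 1 ∧ UnitarilyEquivalent x y

/-- The direct sum of two smooth extensions, formed by means of a spatial isomorphism. -/
def sum (V : IsometryPair (H →L[ℂ] H)) (x y : SmoothExtension τ A) : SmoothExtension τ A where
  π := V.sumHom x.π y.π
  P := V.diag x.P y.P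
  isStarProjection :=
    ⟨by rw [IsIdempotentElem, V.diag_mul, x.isStarProjection.isIdempotentElem,
        y.isStarProjection.isIdempotentElem],
      by rw [IsSelfAdjoint, V.star_diag, x.isStarProjection.isSelfAdjoint,
        y.isStarProjection.isSelfAdjoint]⟩
  commutator_mem a := by
    change V.diag _ _ * V.diag _ _ - V.diag _ _ * V.diag _ _ ∈ τ.ideal
    rw [V.diag_mul, V.diag_mul, V.diag_sub]
    exact τ.ideal.add_mem (τ.mul_mem_right _ (τ.mul_mem_left _ (x.commutator_mem a)))
      (τ.mul_mem_right _ (τ.mul_mem_left _ (y.commutator_mem a)))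
  eq_zero_of_compact a := by
    change IsCompactOperator (V.diag _ _ * V.diag _ _ * V.diag _ _ : H →L[ℂ] H) →
      V.diag _ _ * V.diag _ _ * V.diag _ _ = 0
    rw [V.diag_mul, V.diag_mul]
    intro h
    have h1 := isCompactOperator_mul_right (isCompactOperator_mul_left (star V.s) h) V.s
    have h2 := isCompactOperator_mul_right (isCompactOperator_mul_left (star V.t) h) V.t
    rw [V.star_s_diag_s] at h1
    rw [V.star_t_diag_t] at h2
    rw [x.eq_zero_of_compact a h1, y.eq_zero_of_compact a h2, V.diag_zero]

theorem φ_sum (V : IsometryPair (H →L[ℂ] H)) (x y : SmoothExtension τ A) (a : A.CStar) :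
    (sum V x y).φ a = V.diag (x.φ a) (y.φ a) := by
  change V.diag _ _ * V.diag _ _ * V.diag _ _ = _
  rw [V.diag_mul, V.diag_mul]
  rfl

theorem UnitarilyEquivalent.sum (V : IsometryPair (H →L[ℂ] H)) {x x' y y' : SmoothExtension τ A} :
    UnitarilyEquivalent x x' → UnitarilyEquivalent y y' →
      UnitarilyEquivalent (SmoothExtension.sum V x y) (SmoothExtension.sum V x' y') :=
  fun ⟨u, hu⟩ ⟨w, hw⟩ => ⟨V.diagUnitary u w, fun a => by
    rw [φ_sum, φ_sum]
    change V.diag _ _ * V.diag _ _ * star (V.diag _ _) - V.diag _ _ ∈ τ.ideal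
    rw [V.star_diag, V.diag_mul, V.diag_mul, V.diag_sub]
    exact τ.ideal.add_mem (τ.mul_mem_right _ (τ.mul_mem_left _ (hu a)))
      (τ.mul_mem_right _ (τ.mul_mem_left _ (hw a)))⟩

theorem sum_change (V V' : IsometryPair (H →L[ℂ] H)) (x y : SmoothExtension τ A) :
    UnitarilyEquivalent (sum V x y) (sum V' x y) :=
  .of_eq (V.changeUnitary V') fun a => by rw [φ_sum, φ_sum, V.changeUnitary_conj]

theorem IsDegenerate.sum (V : IsometryPair (H →L[ℂ] H)) {x y : SmoothExtension τ A} :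
    IsDegenerate x → IsDegenerate y → IsDegenerate (SmoothExtension.sum V x y) :=
  fun ⟨x', hx, h⟩ ⟨y', hy, k⟩ => ⟨SmoothExtension.sum V x' y', by
    change V.diag _ _ = 1
    rw [hx, hy, V.diag_one], h.sum V k⟩

/-- The zero representation. -/
def zero (τ : FrechetOperatorIdeal H) (A : SmoothAlgebra.{u}) : SmoothExtension τ A where
  π := 0
  P := 1
  isStarProjection := .one _
  commutator_mem a := by simp
  eq_zero_of_compact a _ := by simp

/-- The pullback of a smooth extension along a morphism of smooth algebras. -/
def pullback (f : A ⟶ B) (x : SmoothExtension τ B) : SmoothExtension τ A where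
  π := x.π.comp (SmoothAlgebra.Hom.extend f)
  P := x.P
  isStarProjection := x.isStarProjection
  commutator_mem a := by
    change x.π (SmoothAlgebra.Hom.extend f (A.ι a)) * x.P -
      x.P * x.π (SmoothAlgebra.Hom.extend f (A.ι a)) ∈ τ.ideal
    rw [SmoothAlgebra.Hom.extend_ι]
    exact x.commutator_mem _
  eq_zero_of_compact a := x.eq_zero_of_compact _

/-- A `τ`-smooth extension is `τ'`-smooth if `τ` is finer than `τ'`. -/
def coarsen (h : τ.Finer τ') (x : SmoothExtension τ A) : SmoothExtension τ' A where
  π := x.π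
  P := x.P
  isStarProjection := x.isStarProjection
  commutator_mem a := h.le (x.commutator_mem a)
  eq_zero_of_compact := x.eq_zero_of_compact

theorem commutator_compact (x : SmoothExtension τ A) (a : A.CStar) :
    IsCompactOperator (x.π a * x.P - x.P * x.π a : H →L[ℂ] H) := by
  have hπ : Continuous x.π :=
    (NonUnitalStarAlgHom.instContinuousLinearMapClassComplex
      (F := A.CStar →⋆ₙₐ[ℂ] (H →L[ℂ] H))).map_continuous x.π
  refine A.denseRange_ι.induction_on (p := fun a =>
    IsCompactOperator (x.π a * x.P - x.P * x.π a : H →L[ℂ] H)) a ?_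
    fun a => τ.isCompactOperator _ (x.commutator_mem a)
  exact isClosed_compact.preimage ((hπ.mul continuous_const).sub (continuous_const.mul hπ))

/-- The Busby invariant `A → L(H)/K(H)`, `a ↦ P π(a) P + K(H)`, of a smooth extension. -/
def busby (x : SmoothExtension τ A) : A.CStar →⋆ₙₐ[ℂ] Calkin H where
  toFun a := Calkin.q (x.φ a)
  map_smul' c a := by simp [φ]
  map_zero' := by simp [φ]
  map_add' a b := by simp [φ, mul_add, add_mul]
  map_mul' a b := by
    have hP : x.P * x.P = x.P := x.isStarProjection.isIdempotentElem
    rw [← map_mul, Calkin.q_eq]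
    have h := isCompactOperator_mul_right
      (isCompactOperator_mul_left (x.P * x.π a) (x.commutator_compact b)) x.P
    convert h using 1
    simp only [φ, map_mul]
    have e : x.P * x.π a * (x.π b * x.P - x.P * x.π b) * x.P =
        x.P * (x.π a * x.π b) * (x.P * x.P) - x.P * x.π a * x.P * x.π b * x.P := by noncomm_ring
    have e' : x.P * x.π a * x.P * (x.P * x.π b * x.P) =
        x.P * x.π a * (x.P * x.P) * x.π b * x.P := by noncomm_ring
    rw [e, e', hP]
  map_star' a := by
    have hP : star x.P = x.P := x.isStarProjection.isSelfAdjoint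
    rw [← map_star]
    congr 1
    simp only [φ, map_star, star_mul, hP, mul_assoc]

end SmoothExtension

/-! ### Extensions of C*-algebras by the compact operators -/

namespace BDF

/-- An extension of the C*-algebra `A` by `K(H)`, given by its Busby invariant. -/
abbrev Extension (H : Type v) [NormedAddCommGroup H] [InnerProductSpace ℂ H] [CompleteSpace H]
    (A : Type u) [NonUnitalCStarAlgebra A] : Type (max u v) :=
  A →⋆ₙₐ[ℂ] Calkin H

namespace Extension

variable {A B : Type u} [NonUnitalCStarAlgebra A] [NonUnitalCStarAlgebra B]

/-- Unitary equivalence of extensions, by unitary operators on `H`. -/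
def UnitarilyEquivalent (σ σ' : Extension H A) : Prop :=
  ∃ u : unitary (H →L[ℂ] H), ∀ a,
    Calkin.q (u : H →L[ℂ] H) * σ a * star (Calkin.q (u : H →L[ℂ] H)) = σ' a

/-- An extension is trivial if it lifts to a `*`-homomorphism into `L(H)`. -/
def IsTrivial (σ : Extension H A) : Prop :=
  ∃ ρ : A →⋆ₙₐ[ℂ] (H →L[ℂ] H), ∀ a, Calkin.q (ρ a) = σ a

/-- The direct sum of extensions, formed by means of a spatial isomorphism. -/
def sum (V : IsometryPair (H →L[ℂ] H)) (σ σ' : Extension H A) : Extension H A :=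
  (V.map Calkin.q).sumHom σ σ'

theorem sum_apply (V : IsometryPair (H →L[ℂ] H)) (σ σ' : Extension H A) (a : A) :
    sum V σ σ' a = (V.map Calkin.q).diag (σ a) (σ' a) := rfl

theorem UnitarilyEquivalent.refl (σ : Extension H A) : UnitarilyEquivalent σ σ :=
  ⟨1, fun a => by simp⟩

theorem UnitarilyEquivalent.symm {σ σ' : Extension H A} :
    UnitarilyEquivalent σ σ' → UnitarilyEquivalent σ' σ := fun ⟨u, hu⟩ =>
  ⟨star u, fun a => by
    have h1 : star (u : H →L[ℂ] H) * (u : H →L[ℂ] H) = 1 := Unitary.coe_star_mul_self u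
    have h2 : star (Calkin.q (u : H →L[ℂ] H)) * Calkin.q (u : H →L[ℂ] H) = 1 := by
      rw [← map_star, ← map_mul, h1, map_one]
    rw [← hu a, Unitary.coe_star, map_star, star_star]
    have e (x y z : Calkin H) : x * (y * z * x) * y = (x * y) * z * (x * y) := by noncomm_ring
    rw [e, h2, one_mul, mul_one]⟩

theorem UnitarilyEquivalent.trans {σ σ' σ'' : Extension H A} :
    UnitarilyEquivalent σ σ' → UnitarilyEquivalent σ' σ'' → UnitarilyEquivalent σ σ'' :=
  fun ⟨u, hu⟩ ⟨w, hw⟩ => ⟨w * u, fun a => by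
    rw [← hw a, ← hu a, Submonoid.coe_mul, map_mul, star_mul]
    noncomm_ring⟩

theorem UnitarilyEquivalent.of_conj (u : unitary (H →L[ℂ] H)) {σ σ' : Extension H A}
    (h : ∀ a, ∃ T T' : H →L[ℂ] H, Calkin.q T = σ a ∧ Calkin.q T' = σ' a ∧
      (u : H →L[ℂ] H) * T * star (u : H →L[ℂ] H) = T') : UnitarilyEquivalent σ σ' :=
  ⟨u, fun a => by
    obtain ⟨T, T', hT, hT', e⟩ := h a
    rw [← hT, ← hT', ← e, map_mul, map_mul, map_star]⟩

theorem exists_lift (σ : Extension H A) (a : A) : ∃ T : H →L[ℂ] H, Calkin.q T = σ a :=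
  Calkin.mk_surjective (σ a)

instance setoid (H : Type v) [NormedAddCommGroup H] [InnerProductSpace ℂ H] [CompleteSpace H]
    (A : Type u) [NonUnitalCStarAlgebra A] : Setoid (Extension H A) where
  r := UnitarilyEquivalent
  iseqv := ⟨.refl, .symm, .trans⟩

theorem UnitarilyEquivalent.sum (V : IsometryPair (H →L[ℂ] H)) {σ σ' ρ ρ' : Extension H A} :
    UnitarilyEquivalent σ σ' → UnitarilyEquivalent ρ ρ' →
      UnitarilyEquivalent (Extension.sum V σ ρ) (Extension.sum V σ' ρ') :=
  fun ⟨u, hu⟩ ⟨w, hw⟩ => ⟨V.diagUnitary u w, fun a => by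
    have e : Calkin.q (V.diagUnitary u w : H →L[ℂ] H) =
        (V.map Calkin.q).diag (Calkin.q (u : H →L[ℂ] H)) (Calkin.q (w : H →L[ℂ] H)) :=
      (V.map_diag Calkin.q _ _).symm
    rw [e, sum_apply, sum_apply, IsometryPair.star_diag, IsometryPair.diag_mul,
      IsometryPair.diag_mul, hu, hw]⟩

theorem sum_change (V V' : IsometryPair (H →L[ℂ] H)) (σ ρ : Extension H A) :
    UnitarilyEquivalent (sum V σ ρ) (sum V' σ ρ) :=
  .of_conj (V.changeUnitary V') fun a => by
    obtain ⟨S, hS⟩ := exists_lift σ a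
    obtain ⟨T, hT⟩ := exists_lift ρ a
    refine ⟨V.diag S T, V'.diag S T, ?_, ?_, V.changeUnitary_conj V' S T⟩ <;>
    rw [← IsometryPair.map_diag, hS, hT, sum_apply]

theorem IsTrivial.sum (V : IsometryPair (H →L[ℂ] H)) {σ σ' : Extension H A} :
    IsTrivial σ → IsTrivial σ' → IsTrivial (Extension.sum V σ σ') :=
  fun ⟨ρ, hρ⟩ ⟨ρ', hρ'⟩ => ⟨V.sumHom ρ ρ', fun a => by
    change Calkin.q (V.diag (ρ a) (ρ' a)) = _
    rw [← IsometryPair.map_diag, hρ, hρ', sum_apply]⟩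

end Extension

end BDF

/-! ### The functors `Ext_τ` and `Ext` -/

variable [SeparableSpace H] [Fact (¬ FiniteDimensional ℂ H)]

/-- A spatial isomorphism. The semigroup structures do not depend on its choice. -/
def stdPair (H : Type v) [NormedAddCommGroup H] [InnerProductSpace ℂ H] [CompleteSpace H]
    [SeparableSpace H] [Fact (¬ FiniteDimensional ℂ H)] : IsometryPair (H →L[ℂ] H) :=
  Classical.choice inferInstance

/-- The unitary equivalence classes of `τ`-smooth extensions. -/
def ExtClass (τ : FrechetOperatorIdeal H) (A : SmoothAlgebra.{u}) : Type (max u v) :=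
  Quotient (SmoothExtension.setoid τ A)

namespace ExtClass

variable {τ : FrechetOperatorIdeal H} {A : SmoothAlgebra.{u}}

/-- The unitary equivalence class of a smooth extension. -/
def mk (x : SmoothExtension τ A) : ExtClass τ A := Quotient.mk _ x

instance : AddCommSemigroup (ExtClass τ A) where
  add := Quotient.map₂ (SmoothExtension.sum (stdPair H)) fun _ _ h _ _ k => h.sum (stdPair H) k
  add_assoc := by
    rintro ⟨x⟩ ⟨y⟩ ⟨z⟩
    exact Quotient.sound (SmoothExtension.UnitarilyEquivalent.of_eq (stdPair H).assocUnitary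
      fun a => by simp only [SmoothExtension.φ_sum, IsometryPair.assocUnitary_conj])
  add_comm := by
    rintro ⟨x⟩ ⟨y⟩
    exact Quotient.sound (SmoothExtension.UnitarilyEquivalent.of_eq (stdPair H).swapUnitary
      fun a => by simp only [SmoothExtension.φ_sum, IsometryPair.swapUnitary_conj])

theorem mk_sum (V : IsometryPair (H →L[ℂ] H)) (x y : SmoothExtension τ A) :
    mk (x.sum V y) = mk x + mk y :=
  Quotient.sound (SmoothExtension.sum_change V (stdPair H) x y)

variable (τ A) in
/-- The subsemigroup of the classes of degenerate extensions. -/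
def degenerate : AddSubsemigroup (ExtClass τ A) where
  carrier := {c | ∃ x : SmoothExtension τ A, x.IsDegenerate ∧ mk x = c}
  add_mem' := by
    rintro _ _ ⟨x, hx, rfl⟩ ⟨y, hy, rfl⟩
    exact ⟨x.sum (stdPair H) y, hx.sum _ hy, rfl⟩

theorem degenerate_nonempty : (degenerate τ A : Set (ExtClass τ A)).Nonempty :=
  ⟨_, SmoothExtension.zero τ A, ⟨SmoothExtension.zero τ A, rfl, .refl _⟩, rfl⟩

end ExtClass

/-- The abelian monoid `Ext_τ(A^∞)`: unitary equivalence classes of `τ`-smooth extensions modulo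
the degenerate ones. -/
def SmoothExt (τ : FrechetOperatorIdeal H) (A : SmoothAlgebra.{u}) : Type (max u v) :=
  StableQuotient (ExtClass.degenerate τ A) ExtClass.degenerate_nonempty

instance (τ : FrechetOperatorIdeal H) (A : SmoothAlgebra.{u}) : AddCommMonoid (SmoothExt τ A) :=
  inferInstanceAs (AddCommMonoid (StableQuotient _ _))

/-- The class of a smooth extension in `Ext_τ(A^∞)`. -/
def SmoothExtension.cls {τ : FrechetOperatorIdeal H} {A : SmoothAlgebra.{u}}
    (x : SmoothExtension τ A) : SmoothExt τ A :=
  StableQuotient.mk (ExtClass.mk x)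

namespace BDF

/-- The unitary equivalence classes of extensions of `A` by `K(H)`. -/
def ExtClass (H : Type v) [NormedAddCommGroup H] [InnerProductSpace ℂ H] [CompleteSpace H]
    (A : Type u) [NonUnitalCStarAlgebra A] : Type (max u v) :=
  Quotient (Extension.setoid H A)

namespace ExtClass

variable {A B : Type u} [NonUnitalCStarAlgebra A] [NonUnitalCStarAlgebra B]

/-- The unitary equivalence class of an extension. -/
def mk (σ : Extension H A) : ExtClass H A := Quotient.mk _ σ

instance : AddCommSemigroup (ExtClass H A) where
  add := Quotient.map₂ (Extension.sum (stdPair H)) fun _ _ h _ _ k => h.sum (stdPair H) k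
  add_assoc := by
    rintro ⟨x⟩ ⟨y⟩ ⟨z⟩
    refine Quotient.sound (Extension.UnitarilyEquivalent.of_conj (stdPair H).assocUnitary
      fun a => ?_)
    obtain ⟨R, hR⟩ := Extension.exists_lift x a
    obtain ⟨S, hS⟩ := Extension.exists_lift y a
    obtain ⟨T, hT⟩ := Extension.exists_lift z a
    refine ⟨_, _, ?_, ?_, (stdPair H).assocUnitary_conj R S T⟩ <;>
    simp only [← IsometryPair.map_diag, hR, hS, hT, Extension.sum_apply]
  add_comm := by
    rintro ⟨x⟩ ⟨y⟩
    refine Quotient.sound (Extension.UnitarilyEquivalent.of_conj (stdPair H).swapUnitary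
      fun a => ?_)
    obtain ⟨S, hS⟩ := Extension.exists_lift x a
    obtain ⟨T, hT⟩ := Extension.exists_lift y a
    refine ⟨_, _, ?_, ?_, (stdPair H).swapUnitary_conj S T⟩ <;>
    simp only [← IsometryPair.map_diag, hS, hT, Extension.sum_apply]

theorem mk_sum (V : IsometryPair (H →L[ℂ] H)) (σ ρ : Extension H A) :
    mk (Extension.sum V σ ρ) = mk σ + mk ρ :=
  Quotient.sound (Extension.sum_change V (stdPair H) σ ρ)

variable (H A) in
/-- The subsemigroup of the classes of trivial extensions. -/
def trivial : AddSubsemigroup (ExtClass H A) where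
  carrier := {c | ∃ σ : Extension H A, σ.IsTrivial ∧ mk σ = c}
  add_mem' := by
    rintro _ _ ⟨x, hx, rfl⟩ ⟨y, hy, rfl⟩
    exact ⟨Extension.sum (stdPair H) x y, hx.sum _ hy, rfl⟩

theorem trivial_nonempty : (trivial H A : Set (ExtClass H A)).Nonempty :=
  ⟨_, 0, ⟨0, fun a => by simp⟩, rfl⟩

/-- Pullback of classes of extensions along a `*`-homomorphism. -/
def pullback (f : A →⋆ₙₐ[ℂ] B) : ExtClass H B →ₙ+ ExtClass H A where
  toFun := Quotient.map (fun σ => NonUnitalStarAlgHom.comp σ f)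
    fun _ _ ⟨u, hu⟩ => ⟨u, fun a => hu (f a)⟩
  map_add' := by
    rintro ⟨x⟩ ⟨y⟩
    rfl

end ExtClass

/-- The abelian monoid `Ext(A)`: unitary equivalence classes of extensions of `A` by the compact
operators modulo the trivial ones. -/
def Ext (H : Type v) [NormedAddCommGroup H] [InnerProductSpace ℂ H] [CompleteSpace H]
    [SeparableSpace H] [Fact (¬ FiniteDimensional ℂ H)]
    (A : Type u) [NonUnitalCStarAlgebra A] : Type (max u v) :=
  StableQuotient (ExtClass.trivial H A) ExtClass.trivial_nonempty

section

variable {A B : Type u} [NonUnitalCStarAlgebra A] [NonUnitalCStarAlgebra B]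

instance : AddCommMonoid (Ext H A) :=
  inferInstanceAs (AddCommMonoid (StableQuotient _ _))

/-- The class of an extension in `Ext(A)`. -/
def Extension.cls (σ : Extension H A) : Ext H A := StableQuotient.mk (ExtClass.mk σ)

/-- The homomorphism `Ext(B) → Ext(A)` induced by a `*`-homomorphism `A → B`. -/
def pullback (f : A →⋆ₙₐ[ℂ] B) : Ext H B →+ Ext H A :=
  StableQuotient.map (ExtClass.pullback f) <| by
    rintro _ ⟨σ, ⟨ρ, hρ⟩, rfl⟩
    exact ⟨NonUnitalStarAlgHom.comp σ f, ⟨ρ.comp f, fun a => hρ (f a)⟩, rfl⟩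

theorem pullback_cls (f : A →⋆ₙₐ[ℂ] B) (σ : Extension H B) :
    pullback f (Extension.cls σ) =
      Extension.cls (H := H) (NonUnitalStarAlgHom.comp σ f : A →⋆ₙₐ[ℂ] Calkin H) :=
  rfl

theorem exists_cls (c : Ext H A) : ∃ σ : Extension H A, Extension.cls σ = c := by
  obtain ⟨⟨σ⟩, rfl⟩ := StableQuotient.mk_surjective c
  exact ⟨σ, rfl⟩

end

/-- The Brown–Douglas–Fillmore functor on the smooth category, `(A^∞, A) ↦ Ext(A)`. -/
def functor (H : Type v) [NormedAddCommGroup H] [InnerProductSpace ℂ H] [CompleteSpace H]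
    [SeparableSpace H] [Fact (¬ FiniteDimensional ℂ H)] :
    SmoothAlgebra.{u}ᵒᵖ ⥤ AddCommMonCat.{max u v} where
  obj A := AddCommMonCat.of (Ext H A.unop.CStar)
  map f := AddCommMonCat.ofHom (pullback (SmoothAlgebra.Hom.extend f.unop))
  map_id A := by
    ext c
    obtain ⟨σ, rfl⟩ := exists_cls c
    change pullback (SmoothAlgebra.Hom.extend (𝟙 A.unop)) (Extension.cls σ) = Extension.cls σ
    rw [SmoothAlgebra.Hom.extend_id]
    rfl
  map_comp {A B C} f g := by
    ext c
    obtain ⟨σ, rfl⟩ := exists_cls c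
    change pullback (SmoothAlgebra.Hom.extend (g.unop ≫ f.unop)) (Extension.cls σ) = _
    rw [SmoothAlgebra.Hom.extend_comp]
    rfl

end BDF

end Extensions

end

/-! The content is the existence of inverses. The first candidate for the inverse of `(π, P)` is
`(π, 1 - P)`, because `π` is block diagonal with respect to `P` modulo `K_τ`: the off-diagonal
blocks `P π(a) (1 - P)` and `(1 - P) π(a) P` are, up to sign, the commutator `[π(a), P]` multiplied
by `P` on one side. Hence `P π P ⊕ (1 - P) π (1 - P)` should be the representation `π` up to unitary
equivalence. The self-adjoint unitary `[[P, 1 - P], [1 - P, P]]` makes this precise on `H ⊕ H`: it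
conjugates `π ⊕ 0` to that sum modulo `K_τ` (`IsometryPair.cornerUnitary_conj`).

The pair `(π, 1 - P)` may fail the requirement that the compression contain no nonzero compact
operator, and so may the representation `π ⊕ 0`. Adding the infinite amplification `π^∞`, with
projection `1`, repairs both: if `T^∞` is compact then `T = 0`, since `T^∞` sends orthogonal copies
of a vector `x` to orthogonal copies of `T x` (`IsometryPair.eq_zero_of_isCompactOperator_amplify`).
The inverse is thus `(π ⊕ π^∞, (1 - P) ⊕ 1)`, and its sum with `(π, P)` is equivalent to `((π ⊕ 0) ⊕
π^∞, 1)` (`SmoothExtension.isDegenerate_sum_complement`).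

Everything else is compatibility. Pulling back along a morphism and enlarging the ideal leave `P`
alone and preserve equivalences and degenerate extensions. For the map to `Ext`, an equivalence
modulo `K_τ` on `A^∞` is an equivalence modulo compact operators on all of `A`, because `A^∞` is
dense and the compact operators are norm closed; a degenerate extension has a Busby invariant
equivalent to one that lifts. -/

noncomputable section

/-! ### Complementary corners -/

namespace IsometryPair

variable {R : Type*} [Ring R] [StarRing R] (V : IsometryPair R)

/-- The unitary with matrix `[[p, 1 - p], [1 - p, p]]`, for a projection `p`. -/
def cornerUnitary {p : R} (hp : IsStarProjection p) : unitary R :=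
  ⟨V.diag p p + (V.s * (1 - p) * star V.t + V.t * (1 - p) * star V.s), by
    have hpp (x : R) : p * (p * x) = p * x := by
      rw [← mul_assoc, hp.isIdempotentElem.eq]
    -- The diagonal entries of the square are `p² + (1 - p)² = 1`; the next two identities kill the
    -- off-diagonal entries. The outer factors `x`, `y` fit the right-associated products below.
    have e (x y : R) : x * (p * (p * y)) + x * ((1 - p) * ((1 - p) * y)) = x * y := by
      rw [sub_mul 1 p ((1 - p) * y), sub_mul 1 p y, mul_sub p, hpp]
      noncomm_ring
    have e' (x y : R) : x * (p * ((1 - p) * y)) = 0 := by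
      rw [sub_mul 1 p y, mul_sub p, hpp, one_mul, sub_self, mul_zero]
    have e'' (x y : R) : x * ((1 - p) * (p * y)) = 0 := by
      rw [sub_mul 1 p (p * y), hpp, one_mul, sub_self, mul_zero]
    -- Self-adjointness reduces both unitarity conditions to the single identity `u * u = 1`.
    have hs : star (V.diag p p + (V.s * (1 - p) * star V.t + V.t * (1 - p) * star V.s)) =
        V.diag p p + (V.s * (1 - p) * star V.t + V.t * (1 - p) * star V.s) := by
      simp only [star_add, star_mul, star_star, V.star_diag, hp.isSelfAdjoint.star_eq, star_sub,
        star_one, mul_assoc]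
      abel
    rw [Unitary.mem_iff, hs, and_self]
    simp only [diag, mul_add, add_mul, mul_assoc, star_s_mul_s', star_s_mul_t', star_t_mul_s',
      star_t_mul_t', mul_zero, add_zero, zero_add, e', e'']
    rw [add_comm (V.t * ((1 - p) * _)), add_add_add_comm, e, e, V.add_eq_one]⟩

/-- Conjugating `a ⊕ 0` gives the matrix of all four corners of `a`. The off-diagonal corners are
`(1 - p) a p = [a, p] p` and `p a (1 - p) = -p [a, p]`; writing them through the commutator shows
that the error lies in any two-sided ideal containing `[a, p]`. -/
theorem cornerUnitary_conj {p : R} (hp : IsStarProjection p) (a : R) :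
    (V.cornerUnitary hp : R) * V.diag a 0 * star (V.cornerUnitary hp : R) -
      V.diag (p * a * p) ((1 - p) * a * (1 - p)) =
    V.t * ((a * p - p * a) * p) * star V.s - V.s * (p * (a * p - p * a)) * star V.t := by
  have hpp : p * p = p := hp.isIdempotentElem
  have e1 : (a * p - p * a) * p = (1 - p) * a * p := by
    rw [sub_mul, mul_assoc, hpp]; noncomm_ring
  have e2 : p * (a * p - p * a) = -(p * a * (1 - p)) := by
    rw [mul_sub, ← mul_assoc p p, hpp]; noncomm_ring
  rw [e1, e2]
  simp only [cornerUnitary, diag, star_add, star_mul, star_star, mul_add, add_mul, mul_assoc,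
    star_s_mul_s', star_s_mul_t', star_t_mul_s', mul_zero, zero_mul, add_zero, zero_add, hp.isSelfAdjoint.star_eq, hp.one_sub.isSelfAdjoint.star_eq, neg_mul, mul_neg]
  abel

end IsometryPair

/-! ### Infinite amplifications -/

section Amplification

set_option linter.unusedSectionVars false

variable {H : Type v} [NormedAddCommGroup H] [InnerProductSpace ℂ H] [CompleteSpace H]

open scoped lp ENNReal

/-- The diagonal operator on `ℓ²(ℕ, H)` with constant entry `T`. -/
def constDiagonal (T : H →L[ℂ] H) : lp (fun _ : ℕ => H) 2 →L[ℂ] lp (fun _ : ℕ => H) 2 :=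
  lp.mapCLM 2 (fun _ => T) (norm_nonneg T) fun _ => le_rfl

theorem constDiagonal_apply (T : H →L[ℂ] H) (f : lp (fun _ : ℕ => H) 2) (n : ℕ) :
    constDiagonal T f n = T (f n) := rfl

theorem constDiagonal_single (T : H →L[ℂ] H) (n : ℕ) (x : H) :
    constDiagonal T (lp.single 2 n x) = lp.single 2 n (T x) := by
  ext m
  rw [constDiagonal_apply, lp.single_apply, lp.single_apply]
  rcases eq_or_ne m n with rfl | h
  · simp
  · simp [h]

/-- The `*`-homomorphism sending an operator to its infinite amplification. -/
def constDiagonalHom (H : Type v) [NormedAddCommGroup H] [InnerProductSpace ℂ H]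
    [CompleteSpace H] :
    (H →L[ℂ] H) →⋆ₙₐ[ℂ] (lp (fun _ : ℕ => H) 2 →L[ℂ] lp (fun _ : ℕ => H) 2) where
  toFun := constDiagonal
  map_smul' _ _ := by ext; rfl
  map_zero' := by ext; rfl
  map_add' _ _ := by ext; rfl
  map_mul' _ _ := by ext; rfl
  map_star' T := by
    rw [ContinuousLinearMap.star_eq_adjoint, ContinuousLinearMap.star_eq_adjoint,
      ContinuousLinearMap.eq_adjoint_iff]
    intro f g
    -- The inner product of `ℓ²(ℕ, H)` is a sum over coordinates, and `T` can be moved across in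
    -- each one.
    rw [lp.inner_eq_tsum, lp.inner_eq_tsum]
    exact tsum_congr fun n => ContinuousLinearMap.adjoint_inner_left T _ _

/-- Conjugation by an isometry, as a `*`-homomorphism. -/
def conjIsometry {K : Type*} [NormedAddCommGroup K] [InnerProductSpace ℂ K] [CompleteSpace K]
    (W : K →ₗᵢ[ℂ] H) : (K →L[ℂ] K) →⋆ₙₐ[ℂ] (H →L[ℂ] H) where
  toFun T := W.toContinuousLinearMap ∘L T ∘L W.toContinuousLinearMap.adjoint
  map_smul' c T := by ext; simp
  map_zero' := by ext; simp
  map_add' S T := by ext; simp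
  map_mul' S T := by
    ext x
    -- Multiplicativity needs only `W* W = 1`; `W` need not be onto, so the homomorphism may be
    -- non-unital.
    have h (y : K) : W.toContinuousLinearMap.adjoint (W y) = y :=
      congrArg (fun f : K →L[ℂ] K => f y) W.adjoint_comp_self
    simp [h]
  map_star' T := by
    simp only [ContinuousLinearMap.star_eq_adjoint, ContinuousLinearMap.adjoint_comp,
      ContinuousLinearMap.adjoint_adjoint, ContinuousLinearMap.comp_assoc]

theorem conjIsometry_apply {K : Type*} [NormedAddCommGroup K] [InnerProductSpace ℂ K]
    [CompleteSpace K] (W : K →ₗᵢ[ℂ] H) (T : K →L[ℂ] K) (x : K) :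
    conjIsometry W T (W x) = W (T x) := by
  have h : W.toContinuousLinearMap.adjoint (W x) = x :=
    congrArg (fun f : K →L[ℂ] K => f x) W.adjoint_comp_self
  change W (T (W.toContinuousLinearMap.adjoint (W x))) = _
  rw [h]

/-! ### Infinitely many orthogonal copies of `H` inside `H`. -/

namespace IsometryPair

variable (V : IsometryPair (H →L[ℂ] H))

/-- The isometries `tⁿ s`, whose ranges are mutually orthogonal. -/
def tower (n : ℕ) : H →ₗᵢ[ℂ] H where
  toLinearMap := (V.t ^ n * V.s : H →L[ℂ] H)
  norm_map' := by
    have : star (V.t ^ n * V.s) * (V.t ^ n * V.s) = 1 := by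
      induction n with
      | zero => simp [V.star_s_mul_s]
      | succ n ih =>
        rw [pow_succ', mul_assoc, star_mul, mul_assoc, V.star_t_mul_t', ih]
    exact (AddMonoidHomClass.isometry_iff_norm (V.t ^ n * V.s : H →L[ℂ] H)).1
      ((ContinuousLinearMap.isometry_iff_adjoint_comp_self _).2 this)

theorem tower_zero (x : H) : V.tower 0 x = V.s x := by
  change (V.t ^ 0 * V.s) x = _
  rw [pow_zero, one_mul]

theorem tower_succ (n : ℕ) (x : H) : V.tower (n + 1) x = V.t (V.tower n x) := by
  change (V.t ^ (n + 1) * V.s) x = V.t ((V.t ^ n * V.s) x)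
  rw [pow_succ', mul_assoc]
  rfl

theorem inner_t_t (x y : H) : inner ℂ (V.t x) (V.t y) = inner ℂ x y := by
  rw [← ContinuousLinearMap.adjoint_inner_right, ← ContinuousLinearMap.star_eq_adjoint]
  exact congrArg (fun f : H →L[ℂ] H => inner ℂ x (f y)) V.star_t_mul_t

theorem inner_s_t (x y : H) : inner ℂ (V.s x) (V.t y) = 0 := by
  rw [← ContinuousLinearMap.adjoint_inner_right, ← ContinuousLinearMap.star_eq_adjoint]
  have := congrArg (fun f : H →L[ℂ] H => inner ℂ x (f y)) V.star_s_mul_t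
  simpa using this

/-- Cancelling the common powers of the isometry `t` leaves a vector in the range of `s` against one
in the range of `t`, and these ranges are orthogonal. -/
theorem inner_tower {m n : ℕ} (h : m < n) (x y : H) :
    inner ℂ (V.tower m x) (V.tower n y) = 0 := by
  induction n generalizing m with
  | zero => omega
  | succ n ih =>
    rw [tower_succ]
    cases m with
    | zero => rw [tower_zero, inner_s_t]
    | succ m => rw [tower_succ, inner_t_t, ih (by omega)]

theorem orthogonalFamily_tower : OrthogonalFamily ℂ (fun _ : ℕ => H) V.tower := by
  intro m n h x y
  rcases h.lt_or_gt with h | h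
  · exact V.inner_tower h x y
  · rw [← inner_conj_symm, V.inner_tower h, map_zero]

/-- The infinite amplification of operators on `H`, realised on `H` along the isometries
`tⁿ s`. -/
def amplify : (H →L[ℂ] H) →⋆ₙₐ[ℂ] (H →L[ℂ] H) :=
  (conjIsometry V.orthogonalFamily_tower.linearIsometry).comp (constDiagonalHom H)

/-- The ranges of the isometries `tⁿ s` need not span `H`, so `amplify` may be degenerate; its
action on these ranges is all that the compactness argument uses. -/
theorem amplify_tower (T : H →L[ℂ] H) (n : ℕ) (x : H) :
    V.amplify T (V.tower n x) = V.tower n (T x) := by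
  rw [← V.orthogonalFamily_tower.linearIsometry_apply_single,
    ← V.orthogonalFamily_tower.linearIsometry_apply_single, ← constDiagonal_single]
  exact conjIsometry_apply _ _ _

/-- An operator with a compact infinite amplification vanishes. -/
theorem eq_zero_of_isCompactOperator_amplify {T : H →L[ℂ] H}
    (hT : IsCompactOperator (V.amplify T)) : T = 0 := by
  ext x
  -- The radius `‖x‖` is chosen so that the ball contains every copy `V.tower n x` of `x`.
  have hK : IsCompact (closure ((V.amplify T : H →ₗ[ℂ] H) '' Metric.closedBall 0 ‖x‖)) :=
    IsCompactOperator.isCompact_closure_image_closedBall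
      (f := (V.amplify T : H →ₗ[ℂ] H)) hT ‖x‖
  have hmem (n : ℕ) : V.tower n (T x) ∈
      closure ((V.amplify T : H →ₗ[ℂ] H) '' Metric.closedBall 0 ‖x‖) :=
    subset_closure ⟨V.tower n x, by simp, V.amplify_tower T n x⟩
  obtain ⟨z, -, φ, hφ, hz⟩ := hK.tendsto_subseq hmem
  -- Consecutive terms of the convergent subsequence have differences tending to zero, while
  -- orthogonality fixes the squared norm of each difference at `2 ‖T x‖ ^ 2`.
  have hd := (hz.comp (Filter.tendsto_add_atTop_nat 1)).sub hz
  rw [sub_self] at hd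
  have hn (n : ℕ) : ‖V.tower (φ (n + 1)) (T x) - V.tower (φ n) (T x)‖ ^ 2 = 2 * ‖T x‖ ^ 2 := by
    have h := V.orthogonalFamily_tower (hφ n.lt_succ_self).ne' (T x) (T x)
    rw [@norm_sub_sq ℂ, h, LinearIsometry.norm_map, LinearIsometry.norm_map]
    simp only [map_zero]
    ring
  have h0 := hd.norm.pow 2
  simp only [Function.comp_apply, hn, norm_zero] at h0
  have := tendsto_nhds_unique h0 tendsto_const_nhds
  simpa using this

end IsometryPair

end Amplification

/-! ### The group structure and functoriality of `Ext_τ` -/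

section

variable {H : Type v} [NormedAddCommGroup H] [InnerProductSpace ℂ H] [CompleteSpace H]

/-! ### Inverses: the complementary extension. -/

namespace SmoothExtension

variable {τ τ' : FrechetOperatorIdeal H} {A B : SmoothAlgebra.{u}}

/-- The complementary extension `(π ⊕ π^∞, (1 - P) ⊕ 1)` of `(π, P)`. -/
def complement (V : IsometryPair (H →L[ℂ] H)) (x : SmoothExtension τ A) :
    SmoothExtension τ A where
  π := V.sumHom x.π (V.amplify.comp x.π)
  P := V.diag (1 - x.P) 1
  isStarProjection :=
    ⟨by rw [IsIdempotentElem, V.diag_mul, x.isStarProjection.one_sub.isIdempotentElem, one_mul],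
      by rw [IsSelfAdjoint, V.star_diag, x.isStarProjection.one_sub.isSelfAdjoint, star_one]⟩
  commutator_mem a := by
    change V.diag _ _ * V.diag _ _ - V.diag _ _ * V.diag _ _ ∈ τ.ideal
    rw [V.diag_mul, V.diag_mul, V.diag_sub, mul_one, one_mul, sub_self, IsometryPair.diag,
      mul_zero, zero_mul, add_zero]
    refine τ.mul_mem_right _ (τ.mul_mem_left _ ?_)
    -- Only the first summand contributes, and the commutator with `1 - P` is minus the commutator
    -- with `P`.
    have e : x.π (A.ι a) * (1 - x.P) - (1 - x.P) * x.π (A.ι a) =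
        -(x.π (A.ι a) * x.P - x.P * x.π (A.ι a)) := by noncomm_ring
    rw [e]
    exact τ.ideal.neg_mem (x.commutator_mem a)
  eq_zero_of_compact a := by
    change IsCompactOperator (V.diag _ _ * V.diag _ _ * V.diag _ _ : H →L[ℂ] H) →
      V.diag _ _ * V.diag _ _ * V.diag _ _ = 0
    rw [V.diag_mul, V.diag_mul, mul_one, one_mul]
    intro h
    -- Compressing to the amplified summand shows that `π(a)^∞` is compact. This forces `π(a) = 0`,
    -- so the corner by `1 - P`, which could be compact and nonzero on its own, vanishes too.
    have h2 := isCompactOperator_mul_right (isCompactOperator_mul_left (star V.t) h) V.t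
    rw [V.star_t_diag_t] at h2
    have h0 : x.π a = 0 := V.eq_zero_of_isCompactOperator_amplify h2
    change V.diag _ (V.amplify (x.π a)) = 0
    rw [h0, map_zero, mul_zero, zero_mul, V.diag_zero]

/-- The representation `(π ⊕ 0) ⊕ π^∞`. -/
def dilation (V : IsometryPair (H →L[ℂ] H)) (x : SmoothExtension τ A) :
    SmoothExtension τ A where
  π := V.sumHom (V.sumHom x.π 0) (V.amplify.comp x.π)
  P := 1
  isStarProjection := .one _
  commutator_mem a := by simp
  eq_zero_of_compact a := by
    rw [one_mul, mul_one]
    change IsCompactOperator (V.diag (V.diag (x.π a) 0) (V.amplify (x.π a)) : H →L[ℂ] H) →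
      V.diag (V.diag (x.π a) 0) (V.amplify (x.π a)) = 0
    intro h
    -- The summand `π^∞` excludes nonzero compact values here as well; `π ⊕ 0` alone could take
    -- them.
    have h2 := isCompactOperator_mul_right (isCompactOperator_mul_left (star V.t) h) V.t
    rw [V.star_t_diag_t] at h2
    rw [V.eq_zero_of_isCompactOperator_amplify h2, map_zero, V.diag_zero, V.diag_zero]

/-- The corner unitary splits `π ⊕ 0` into its corners by `P` and `1 - P` modulo `K_τ` and leaves
`π^∞` fixed; reassociating the three summands then gives the sum of the extension and its
complement. The equivalence is built starting from the dilation, hence the use of symmetry. -/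
theorem isDegenerate_sum_complement (V : IsometryPair (H →L[ℂ] H)) (x : SmoothExtension τ A) :
    IsDegenerate (x.sum V (x.complement V)) := by
  refine ⟨x.dilation V, rfl, UnitarilyEquivalent.symm
    ⟨V.assocUnitary * V.diagUnitary (V.cornerUnitary x.isStarProjection) 1, fun a => ?_⟩⟩
  have h1 : (x.dilation V).φ (A.ι a) =
      V.diag (V.diag (x.π (A.ι a)) 0) (V.amplify (x.π (A.ι a))) := by
    rw [φ]
    change 1 * _ * 1 = _
    rw [one_mul, mul_one]
    rfl
  have h2 : (x.sum V (x.complement V)).φ (A.ι a) =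
      V.diag (x.P * x.π (A.ι a) * x.P) (V.diag ((1 - x.P) * x.π (A.ι a) * (1 - x.P))
        (V.amplify (x.π (A.ι a)))) := by
    rw [φ_sum]
    congr 1
    change V.diag _ _ * V.diag _ _ * V.diag _ _ = _
    rw [V.diag_mul, V.diag_mul, mul_one, one_mul]
    rfl
  -- Writing the target as a conjugate by the reassociating unitary lets that unitary be factored
  -- out of the difference, and an ideal absorbs it.
  rw [h1, h2, ← V.assocUnitary_conj, Submonoid.coe_mul, star_mul]
  have e (w u d b : H →L[ℂ] H) : w * u * d * (star u * star w) - w * b * star w =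
      w * (u * d * star u - b) * star w := by noncomm_ring
  rw [e]
  refine τ.mul_mem_right _ (τ.mul_mem_left _ ?_)
  change V.diag _ _ * V.diag _ _ * star (V.diag _ _) - V.diag _ _ ∈ τ.ideal
  rw [V.star_diag, V.diag_mul, V.diag_mul, V.diag_sub, V.cornerUnitary_conj]
  -- The first summand is the commutator error of `cornerUnitary_conj`; on the amplified summand the
  -- unitary is `1` and the difference is zero.
  refine τ.ideal.add_mem (τ.mul_mem_right _ (τ.mul_mem_left _ (τ.ideal.sub_mem
    (τ.mul_mem_right _ (τ.mul_mem_left _ (τ.mul_mem_right _ (x.commutator_mem a))))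
    (τ.mul_mem_right _ (τ.mul_mem_left _ (τ.mul_mem_left _ (x.commutator_mem a))))))) ?_
  simp

/-! ### Invariance under pullback, change of ideal and the Busby map. -/

theorem UnitarilyEquivalent.pullback (f : A ⟶ B) {x y : SmoothExtension τ B} :
    UnitarilyEquivalent x y →
      UnitarilyEquivalent (SmoothExtension.pullback f x) (SmoothExtension.pullback f y) :=
  fun ⟨u, hu⟩ => ⟨u, fun a => by
    change _ * x.φ (SmoothAlgebra.Hom.extend f (A.ι a)) * _ -
      y.φ (SmoothAlgebra.Hom.extend f (A.ι a)) ∈ _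
    rw [SmoothAlgebra.Hom.extend_ι]
    exact hu _⟩

theorem IsDegenerate.pullback (f : A ⟶ B) {x : SmoothExtension τ B} :
    IsDegenerate x → IsDegenerate (SmoothExtension.pullback f x) :=
  fun ⟨y, hy, h⟩ => ⟨SmoothExtension.pullback f y, hy, h.pullback f⟩

theorem UnitarilyEquivalent.coarsen (h : τ.Finer τ') {x y : SmoothExtension τ A} :
    UnitarilyEquivalent x y →
      UnitarilyEquivalent (SmoothExtension.coarsen h x) (SmoothExtension.coarsen h y) :=
  fun ⟨u, hu⟩ => ⟨u, fun a => h.le (hu a)⟩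

theorem IsDegenerate.coarsen (h : τ.Finer τ') {x : SmoothExtension τ A} :
    IsDegenerate x → IsDegenerate (SmoothExtension.coarsen h x) :=
  fun ⟨y, hy, k⟩ => ⟨SmoothExtension.coarsen h y, hy, k.coarsen h⟩

/-- A `*`-homomorphism of C*-algebras is automatically continuous; compression by `P` preserves
this. -/
theorem continuous_φ (x : SmoothExtension τ A) : Continuous x.φ := by
  have hπ : Continuous x.π :=
    (NonUnitalStarAlgHom.instContinuousLinearMapClassComplex
      (F := A.CStar →⋆ₙₐ[ℂ] (H →L[ℂ] H))).map_continuous x.π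
  exact (continuous_const.mul hπ).mul continuous_const

theorem UnitarilyEquivalent.busby {x y : SmoothExtension τ A} :
    UnitarilyEquivalent x y → BDF.Extension.UnitarilyEquivalent x.busby y.busby :=
  fun ⟨u, hu⟩ => ⟨u, fun a => by
    change Calkin.q _ * Calkin.q (x.φ a) * star (Calkin.q _) = Calkin.q (y.φ a)
    rw [← map_star, ← map_mul, ← map_mul, Calkin.q_eq]
    -- The hypothesis concerns only `A^∞`. Compactness of the difference is a closed condition on
    -- `a`, so it passes to the completion.
    refine A.denseRange_ι.induction_on (p := fun a => IsCompactOperator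
      ((u : H →L[ℂ] H) * x.φ a * star (u : H →L[ℂ] H) - y.φ a : H →L[ℂ] H)) a ?_
      fun a => τ.isCompactOperator _ (hu a)
    exact isClosed_compact.preimage
      (((continuous_const.mul x.continuous_φ).mul continuous_const).sub y.continuous_φ)⟩

theorem busby_sum (V : IsometryPair (H →L[ℂ] H)) (x y : SmoothExtension τ A) :
    (x.sum V y).busby = BDF.Extension.sum V x.busby y.busby := by
  ext a
  rw [BDF.Extension.sum_apply]
  change Calkin.q ((x.sum V y).φ a) = (V.map Calkin.q).diag (Calkin.q (x.φ a)) (Calkin.q (y.φ a))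
  rw [φ_sum, IsometryPair.map_diag]

/-- With `P = 1` there is no compression, so `π` itself is the lift. -/
theorem isTrivial_busby {x : SmoothExtension τ A} (hx : x.P = 1) :
    BDF.Extension.IsTrivial x.busby :=
  ⟨x.π, fun a => by
    change _ = Calkin.q (x.P * x.π a * x.P)
    rw [hx, one_mul, mul_one]⟩

end SmoothExtension

/-! ### Descent to equivalence classes. -/

variable [SeparableSpace H] [Fact (¬ FiniteDimensional ℂ H)]
variable {τ τ' : FrechetOperatorIdeal H} {A B C : SmoothAlgebra.{u}}

namespace ExtClass

/-- Pullback of unitary equivalence classes along a morphism of smooth algebras. -/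
def pullback (τ : FrechetOperatorIdeal H) (f : A ⟶ B) : ExtClass τ B →ₙ+ ExtClass τ A where
  toFun := Quotient.map (SmoothExtension.pullback f) fun _ _ h => h.pullback f
  map_add' := by
    rintro ⟨x⟩ ⟨y⟩
    rfl

/-- The map on unitary equivalence classes given by a finer topology. -/
def coarsen (h : τ.Finer τ') (A : SmoothAlgebra.{u}) : ExtClass τ A →ₙ+ ExtClass τ' A where
  toFun := Quotient.map (SmoothExtension.coarsen h) fun _ _ k => k.coarsen h
  map_add' := by
    rintro ⟨x⟩ ⟨y⟩
    rfl

/-- The map sending the class of a smooth extension to that of its Busby invariant. -/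
def busby (τ : FrechetOperatorIdeal H) (A : SmoothAlgebra.{u}) :
    ExtClass τ A →ₙ+ BDF.ExtClass H A.CStar where
  toFun := Quotient.map SmoothExtension.busby fun _ _ h => h.busby
  map_add' := by
    rintro ⟨x⟩ ⟨y⟩
    exact congrArg BDF.ExtClass.mk (SmoothExtension.busby_sum (stdPair H) x y)

end ExtClass

/-! ### `Ext_τ` as a group-valued functor and its natural transformations. -/

namespace SmoothExt

theorem exists_cls (c : SmoothExt τ A) : ∃ x : SmoothExtension τ A, x.cls = c := by
  obtain ⟨⟨x⟩, rfl⟩ := StableQuotient.mk_surjective c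
  exact ⟨x, rfl⟩

theorem exists_add_eq_zero (c : SmoothExt τ A) : ∃ d : SmoothExt τ A, d + c = 0 := by
  obtain ⟨x, rfl⟩ := exists_cls c
  refine ⟨(x.complement (stdPair H)).cls, ?_⟩
  rw [add_comm]
  exact StableQuotient.mk_of_mem ⟨_, x.isDegenerate_sum_complement (stdPair H), rfl⟩

/-- Inverses in a commutative monoid are unique, so choosing a negative for each class involves no
ambiguity. -/
instance : AddCommGroup (SmoothExt τ A) :=
  letI : Neg (SmoothExt τ A) := ⟨fun c => (exists_add_eq_zero c).choose⟩
  { (inferInstance : AddCommMonoid (SmoothExt τ A)) with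
    zsmul := zsmulRec
    neg_add_cancel := fun c => (exists_add_eq_zero c).choose_spec }

/-- The homomorphism `Ext_τ(B^∞) → Ext_τ(A^∞)` induced by a morphism `A^∞ → B^∞`. -/
def pullback (τ : FrechetOperatorIdeal H) (f : A ⟶ B) : SmoothExt τ B →+ SmoothExt τ A :=
  StableQuotient.map (ExtClass.pullback τ f) <| by
    rintro _ ⟨x, hx, rfl⟩
    exact ⟨x.pullback f, hx.pullback f, rfl⟩

/-- The homomorphism `Ext_τ(A^∞) → Ext_τ'(A^∞)` for `τ` finer than `τ'`. -/
def coarsen (h : τ.Finer τ') (A : SmoothAlgebra.{u}) : SmoothExt τ A →+ SmoothExt τ' A :=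
  StableQuotient.map (ExtClass.coarsen h A) <| by
    rintro _ ⟨x, hx, rfl⟩
    exact ⟨x.coarsen h, hx.coarsen h, rfl⟩

/-- The homomorphism `Ext_τ(A^∞) → Ext(A)`. -/
def busby (τ : FrechetOperatorIdeal H) (A : SmoothAlgebra.{u}) :
    SmoothExt τ A →+ BDF.Ext H A.CStar :=
  StableQuotient.map (ExtClass.busby τ A) <| by
    rintro _ ⟨x, ⟨y, hy, h⟩, rfl⟩
    -- A degenerate `x` need not have `P = 1`; its Busby class is represented instead by that of the
    -- equivalent `y`, for which `P = 1` gives a lift.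
    exact ⟨y.busby, SmoothExtension.isTrivial_busby hy, Quotient.sound h.symm.busby⟩

/-- The functor `Ext_τ` from the smooth category to abelian groups. -/
def functor (τ : FrechetOperatorIdeal H) :
    SmoothAlgebra.{u}ᵒᵖ ⥤ AddCommGrpCat.{max u v} where
  obj A := AddCommGrpCat.of (SmoothExt τ A.unop)
  map f := AddCommGrpCat.ofHom (pullback τ f.unop)
  map_id A := by
    ext c
    obtain ⟨x, rfl⟩ := exists_cls c
    change (x.pullback (𝟙 A.unop)).cls = x.cls
    rw [SmoothExtension.pullback]
    simp only [SmoothAlgebra.Hom.extend_id]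
    rfl
  map_comp f g := by
    ext c
    obtain ⟨x, rfl⟩ := exists_cls c
    change (x.pullback (g.unop ≫ f.unop)).cls = ((x.pullback f.unop).pullback g.unop).cls
    rw [SmoothExtension.pullback]
    simp only [SmoothAlgebra.Hom.extend_comp]
    rfl

/-- The natural transformation `Ext_τ → Ext_τ'` for `τ` finer than `τ'`. -/
def coarsenNatTrans (h : τ.Finer τ') : functor.{u} τ ⟶ functor τ' where
  app A := AddCommGrpCat.ofHom (coarsen h A.unop)
  naturality A B f := by
    ext c
    obtain ⟨x, rfl⟩ := exists_cls c
    rfl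

/-- The natural transformation from `Ext_τ` to the Brown–Douglas–Fillmore functor. -/
def busbyNatTrans (τ : FrechetOperatorIdeal H) :
    functor.{u} τ ⋙ forget₂ AddCommGrpCat AddCommMonCat ⟶ BDF.functor H where
  app A := AddCommMonCat.ofHom (busby τ A.unop)
  naturality A B f := by
    ext c
    obtain ⟨x, rfl⟩ := exists_cls c
    rfl

end SmoothExt

end

end

/-- The additive equivalences `e` express that the monoid already defined is itself a group; they
are taken to be identities, and the formulas then hold by construction on representatives. The last
transformation passes through the forgetful functor because its target takes values in monoids. -/
theorem mainTheorem5 {H : Type v} [NormedAddCommGroup H] [InnerProductSpace ℂ H]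
    [CompleteSpace H] [SeparableSpace H] [Fact (¬ FiniteDimensional ℂ H)] :
    ∃ (Ext : FrechetOperatorIdeal H → (SmoothAlgebra.{u}ᵒᵖ ⥤ AddCommGrpCat.{max u v}))
      (e : ∀ (τ : FrechetOperatorIdeal H) (A : SmoothAlgebra.{u}),
        SmoothExt τ A ≃+ (Ext τ).obj (op A)),
      (∀ (τ : FrechetOperatorIdeal H) (A B : SmoothAlgebra.{u}) (f : A ⟶ B)
        (x : SmoothExtension τ B),
        (Ext τ).map f.op (e τ B x.cls) = e τ A (x.pullback f).cls) ∧
      (∀ (τ τ' : FrechetOperatorIdeal H) (h : τ.Finer τ'),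
        ∃ α : Ext τ ⟶ Ext τ', ∀ (A : SmoothAlgebra.{u}) (x : SmoothExtension τ A),
          α.app (op A) (e τ A x.cls) = e τ' A (x.coarsen h).cls) ∧
      (∀ τ : FrechetOperatorIdeal H,
        ∃ α : Ext τ ⋙ forget₂ AddCommGrpCat AddCommMonCat ⟶ BDF.functor H,
          ∀ (A : SmoothAlgebra.{u}) (x : SmoothExtension τ A),
            α.app (op A) (e τ A x.cls) = BDF.Extension.cls x.busby) :=
  ⟨SmoothExt.functor, fun _ _ => AddEquiv.refl _, fun _ _ _ _ _ => rfl,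
    fun _ _ h => ⟨SmoothExt.coarsenNatTrans h, fun _ _ => rfl⟩,
    fun τ => ⟨SmoothExt.busbyNatTrans τ, fun _ _ => rfl⟩⟩
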